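/- Let $d\in\mathbb N$, $\varepsilon>0$, and let $\mu=\exp(-V)$ be a probability density on $\mathbb R^d$ with $V$ twice differentiable and $\nabla^2V(x)\succcurlyeq c_vI$ for all $x$, where $c_v>\frac1{4\varepsilon}$. Let $h:\mathbb R^d\to\mathbb R$ be $C^1$ and globally Lipschitz. Put $\tilde g_\varepsilon(x,y)=(4\pi\varepsilon)^{-d/2}\exp(-\frac1{4\varepsilon}|x-y|^2)$, $$k_\varepsilon(x,y)=\frac{\tilde g_\varepsilon(x,y)}{\big(\int\tilde g_\varepsilon(x,z)\mu(z)\,dz\big)^{1/2}\big(\int\tilde g_\varepsilon(y,z)\mu(z)\,dz\big)^{1/2}},\qquad p_\varepsilon(x,y)=\frac{k_\varepsilon(x,y)\mu(y)}{\int k_\varepsilon(x,z)\mu(z)\,dz},$$ $T_\varepsilon f(x)=\int p_\varepsilon(x,y)f(y)\,dy$, and let $\pi_\varepsilon$ be the probability density proportional to $x\mapsto\mu(x)\int k_\varepsilon(x,z)\mu(z)\,dz$, and $\hat h_\varepsilon=\int h\,\pi_\varepsilon\,dx$, the last integral being absolutely convergent. Consider the fixed point equation $$\phi_\varepsilon=T_\varepsilon\phi_\varepsilon+\varepsilon(h-\hat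 h_\varepsilon)\quad\text{on }\mathbb R^d,$$ where a solution is a $\pi_\varepsilon$-integrable function $\phi_\varepsilon:\mathbb R^d\to\mathbb R$ for which all integrals $T_\varepsilon\phi_\varepsilon(x)$ converge absolutely and the equation holds at every $x$. It has a solution, unique up to an additive constant. For every solution $\phi_\varepsilon$, with $\mathcal R_\varepsilon=\phi_\varepsilon+\varepsilon h$, the mean-field gain $$\bar K_\varepsilon(x,\mu)=\frac1{2\varepsilon}\int\mathcal R_\varepsilon(y)\,y\,p_\varepsilon(x,y)\,dy-\frac1{2\varepsilon}\Big(\int y\,p_\varepsilon(x,y)\,dy\Big)\Big(\int\mathcal R_\varepsilon(y)\,p_\varepsilon(x,y)\,dy\Big)$$ is given by absolutely convergent integrals, is differentiable in $x$, and satisfies, with $c_g=\frac1{4\varepsilon}+c_v$ and $\|\nabla h\|_\infty=\sup_x|\nabla h(x)|$, for all $x\in\mathbb R^d$, $$\|\bar K_\varepsilon(x,\mu)\|\le\frac{\|\nabla h\|_\infty}{2c_g}\Big(\frac{4\varepsilon c_g-1}{2\varepsilon c_g-1}\Big),\qquad \|\nabla_x\bar K_\varepsilon(x,\mu)\|_F\le\frac{d\,\|\nabla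 h\|_\infty}{\varepsilon}\,\frac1{c_g^{3/2}}\Big(\frac{4\varepsilon c_g-1}{2\varepsilon c_g-1}\Big),$$ where $\|\cdot\|$ is the Euclidean norm and $\|\cdot\|_F$ the Frobenius norm. -/

import Mathlib

open MeasureTheory

noncomputable section

namespace DiffusionMapGain

variable {d : ℕ}

/-- `ρ` is a strongly log-concave probability density on `ℝᵈ` with constant `c`: it is of the form
`exp (-V)` with `V` twice differentiable and `∇²V(x) ≽ c I` for all `x`. -/
def IsStronglyLogConcaveDensity (c : ℝ) (ρ : EuclideanSpace ℝ (Fin d) → ℝ) : Prop :=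
  (∫ x, ρ x) = 1 ∧
  ∃ V : EuclideanSpace ℝ (Fin d) → ℝ,
    Differentiable ℝ V ∧ Differentiable ℝ (fderiv ℝ V) ∧
    (∀ x, ρ x = Real.exp (-V x)) ∧
    ∀ x v, c * ‖v‖ ^ 2 ≤ fderiv ℝ (fderiv ℝ V) x v v

/-- The Gaussian kernel `(4πε)^(-d/2) exp (-|x - y|² / (4ε))`. -/
def gaussKernel (ε : ℝ) (x y : EuclideanSpace ℝ (Fin d)) : ℝ :=
  (4 * Real.pi * ε) ^ (-(d : ℝ) / 2) * Real.exp (-(1 / (4 * ε)) * ‖x - y‖ ^ 2)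

/-- `(a * ρ)(x) = ∫ a(x, y) ρ(y) dy`. -/
def kernelConv (a : EuclideanSpace ℝ (Fin d) → EuclideanSpace ℝ (Fin d) → ℝ)
    (ρ : EuclideanSpace ℝ (Fin d) → ℝ) (x : EuclideanSpace ℝ (Fin d)) : ℝ :=
  ∫ y, a x y * ρ y

/-- The anisotropic kernel `k_ε(x, y)`. -/
def kKernel (ε : ℝ) (ρ : EuclideanSpace ℝ (Fin d) → ℝ) (x y : EuclideanSpace ℝ (Fin d)) : ℝ :=
  gaussKernel ε x y /
    (Real.sqrt (kernelConv (gaussKernel ε) ρ x) * Real.sqrt (kernelConv (gaussKernel ε) ρ y))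

/-- The Markov transition density `p_ε(x, y) = k_ε(x, y) ρ(y) / (k_ε * ρ)(x)`. -/
def pKernel (ε : ℝ) (ρ : EuclideanSpace ℝ (Fin d) → ℝ) (x y : EuclideanSpace ℝ (Fin d)) : ℝ :=
  kKernel ε ρ x y * ρ y / kernelConv (kKernel ε ρ) ρ x

/-- The Markov operator `T_ε f(x) = ∫ p_ε(x, y) f(y) dy`. -/
def markovOp (ε : ℝ) (ρ : EuclideanSpace ℝ (Fin d) → ℝ) (f : EuclideanSpace ℝ (Fin d) → ℝ)
    (x : EuclideanSpace ℝ (Fin d)) : ℝ :=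
  ∫ y, pKernel ε ρ x y * f y

/-- The invariant density `π_ε = ρ (k_ε * ρ) / ∫ ρ (k_ε * ρ)`. -/
def invDensity (ε : ℝ) (ρ : EuclideanSpace ℝ (Fin d) → ℝ) (x : EuclideanSpace ℝ (Fin d)) : ℝ :=
  ρ x * kernelConv (kKernel ε ρ) ρ x / ∫ z, ρ z * kernelConv (kKernel ε ρ) ρ z

/-- `ĥ_ε = ∫ h(x) π_ε(x) dx`. -/
def hHat (ε : ℝ) (ρ h : EuclideanSpace ℝ (Fin d) → ℝ) : ℝ :=
  ∫ x, h x * invDensity ε ρ x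

/-- `φ` solves the fixed point equation `φ = T_ε φ + ε (h - ĥ_ε)` at every point, where `φ` is
`π_ε`-integrable and all the integrals `T_ε φ(x)` converge. -/
structure IsFixedPointSolution (ε : ℝ) (ρ h φ : EuclideanSpace ℝ (Fin d) → ℝ) : Prop where
  integrable_inv : Integrable fun x => φ x * invDensity ε ρ x
  integrable_op : ∀ x, Integrable fun y => pKernel ε ρ x y * φ y
  eq : ∀ x, φ x = markovOp ε ρ φ x + ε * (h x - hHat ε ρ h)

/-- `R_ε = φ + ε h`. -/
def rFun (ε : ℝ) (h φ : EuclideanSpace ℝ (Fin d) → ℝ) (y : EuclideanSpace ℝ (Fin d)) : ℝ :=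
  φ y + ε * h y

/-- The mean-field gain
`(1/2ε) ∫ R_ε(y) y p_ε(x,y) dy - (1/2ε) (∫ y p_ε(x,y) dy) (∫ R_ε(y) p_ε(x,y) dy)`. -/
def meanFieldGain (ε : ℝ) (ρ h φ : EuclideanSpace ℝ (Fin d) → ℝ)
    (x : EuclideanSpace ℝ (Fin d)) : EuclideanSpace ℝ (Fin d) :=
  (1 / (2 * ε)) • (∫ y, (rFun ε h φ y * pKernel ε ρ x y) • y) -
    (1 / (2 * ε)) •
      ((∫ y, rFun ε h φ y * pKernel ε ρ x y) • (∫ y, pKernel ε ρ x y • y))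

/-- All the integrals in the mean-field gain at `x` converge absolutely. -/
def GainIntegrable (ε : ℝ) (ρ h φ : EuclideanSpace ℝ (Fin d) → ℝ)
    (x : EuclideanSpace ℝ (Fin d)) : Prop :=
  Integrable (fun y => (rFun ε h φ y * pKernel ε ρ x y) • y) ∧
  Integrable (fun y => rFun ε h φ y * pKernel ε ρ x y) ∧
  Integrable (fun y => pKernel ε ρ x y • y)

/-- The Frobenius norm of the Jacobian matrix `(∂ K_i / ∂ x_j)` of `K` at `x`. -/
def jacobianFrobenius (K : EuclideanSpace ℝ (Fin d) → EuclideanSpace ℝ (Fin d))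
    (x : EuclideanSpace ℝ (Fin d)) : ℝ :=
  Real.sqrt (∑ i, ∑ j, (fderiv ℝ K x (EuclideanSpace.single j 1) i) ^ 2)

/-- `‖∇h‖_∞ = sup_x |∇h(x)|`. -/
def gradSup (h : EuclideanSpace ℝ (Fin d) → ℝ) : ℝ :=
  ⨆ x, ‖gradient h x‖

end DiffusionMapGain

end

/-! Put β = 1/(2ε). Expanding |x - y|² and cancelling everything that depends on x alone turns the
transition density into an exponential family, p(x,y) = exp(β⟪x,y⟫) q(y) / Z(x), with q =
exp(-β|·|²/4 - V) / √M and M(x) = ∫ exp(β⟪x,z⟫ - β|z|²/2 - V(z)) dz. By Cauchy–Schwarz M is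
log-convex, so dividing by √M only helps log-concavity: q, and with it every p(x,·), is strongly
log-concave with constant β/2 + c_v = c_g (`isTiltBase_tiltBase`, `isTiltRepresentation`).

Strong log-concavity yields concentration through the Prékopa–Leindler inequality: ∫e^f · ∫e^(-f) ≤
e^(L²/c) for every L-Lipschitz f (`LipschitzConcentration.of_midpoint`). Comparing cosh with its
Taylor polynomial gives variance at most L²/c, and centred fourth moment at most 16/c² when L = 1.
By Cauchy–Schwarz these control covariances and third cumulants.

In an exponential family, differentiating a mean in x produces β times a covariance
(`fderiv_tiltMean`). Hence T_ε multiplies Lipschitz constants by β/c_g, which is below 1 exactly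
because c_v > 1/(4ε). The Neumann series therefore solves the equation, with Lipschitz constant
ε‖∇h‖/(1 - β/c_g). Uniqueness up to constants comes from reversibility of T_ε for the weight qZ,
proportional to π_ε, and from strict positivity of the kernel. Every solution thus inherits that
Lipschitz bound, and R_ε has constant M = ε‖∇h‖(4εc_g - 1)/(2εc_g - 1).

The gain is β times the covariance of R_ε and y, hence at most βM/c_g. Its Jacobian entries are β²
times third cumulants, each at most 4β²M/c_g^(3/2), and d² of them give the factor d in the
Frobenius norm. -/

/-! ### The Prékopa–Leindler inequality for midpoints -/

/-- One-dimensional Brunn–Minkowski. For compact sets with a = max A and b = min B, the translates A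
+ b and a + B meet only at a + b and both lie in 2C; inner regularity gives the general case. -/
theorem volume_add_volume_le_of_midpoint_mem {A B C : Set ℝ} (hA : MeasurableSet A)
    (hB : MeasurableSet B) (hA' : A.Nonempty) (hB' : B.Nonempty)
    (h : ∀ x ∈ A, ∀ y ∈ B, (x + y) / 2 ∈ C) : volume A + volume B ≤ 2 * volume C := by
  obtain ⟨x₀, hx₀⟩ := hA'
  obtain ⟨y₀, hy₀⟩ := hB'
  have key : ∀ K ⊆ A, IsCompact K → ∀ K' ⊆ B, IsCompact K' →
      volume K + volume K' ≤ 2 * volume C := by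
    intro K hKA hK K' hKB hK'
    -- Adjoining a point keeps the compact sets nonempty, so that the maximum and minimum exist even
    -- for K = ∅ or K' = ∅.
    have hLA : insert x₀ K ⊆ A := Set.insert_subset hx₀ hKA
    have hLB : insert y₀ K' ⊆ B := Set.insert_subset hy₀ hKB
    have hL : IsCompact (insert x₀ K) := hK.insert x₀
    have hL' : IsCompact (insert y₀ K') := hK'.insert y₀
    obtain ⟨a, haL, ha⟩ := hL.exists_isGreatest ⟨x₀, by simp⟩
    obtain ⟨b, hbL, hb⟩ := hL'.exists_isLeast ⟨y₀, by simp⟩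
    set S : Set ℝ := (fun t => t - b) ⁻¹' (insert x₀ K)
    set T : Set ℝ := (fun t => t - a) ⁻¹' (insert y₀ K')
    have hT : MeasurableSet T := (measurable_id.sub_const a) hL'.measurableSet
    have hSv : volume S = volume (insert x₀ K) := by
      simp [S, sub_eq_add_neg]
    have hTv : volume T = volume (insert y₀ K') := by
      simp [T, sub_eq_add_neg]
    have hdisj : AEDisjoint volume S T := by
      refine measure_mono_null (t := {a + b}) ?_ (by simp)
      rintro t ⟨h1, h2⟩
      have h3 := ha h1
      have h4 := hb h2
      simp only [Set.mem_singleton_iff]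
      linarith
    have hsub : S ∪ T ⊆ (fun t => t * (1 / 2)) ⁻¹' C := by
      rintro t (ht | ht)
      · have := h _ (hLA ht) _ (hLB hbL)
        simpa [div_eq_mul_inv] using this
      · have := h _ (hLA haL) _ (hLB ht)
        simpa [div_eq_mul_inv] using this
    calc volume K + volume K' ≤ volume S + volume T := by
          rw [hSv, hTv]
          exact add_le_add (measure_mono (Set.subset_insert _ _))
            (measure_mono (Set.subset_insert _ _))
      _ = volume (S ∪ T) := (measure_union₀ hT.nullMeasurableSet hdisj).symm
      _ ≤ volume ((fun t => t * (1 / 2)) ⁻¹' C) := measure_mono hsub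
      _ = 2 * volume C := by
          rw [Real.volume_preimage_mul_right (by norm_num)]
          simp
  by_cases hC : 2 * volume C = ⊤
  · simp [hC]
  -- The suprema over K and K' are taken one at a time, so that each subtraction in `ENNReal`
  -- removes a finite measure.
  have h1 : ∀ K' ⊆ B, IsCompact K' → volume A + volume K' ≤ 2 * volume C := fun K' hKB hK' => by
    refine add_le_of_le_tsub_right_of_le
      (by simpa using key ∅ (Set.empty_subset _) isCompact_empty K' hKB hK') ?_
    rw [hA.measure_eq_iSup_isCompact]
    exact iSup₂_le fun K hKA => iSup_le fun hK =>
      ENNReal.le_sub_of_add_le_right hK'.measure_lt_top.ne (key K hKA hK K' hKB hK')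
  have h2 : volume A ≤ 2 * volume C := by
    simpa using h1 ∅ (Set.empty_subset _) isCompact_empty
  refine add_le_of_le_tsub_left_of_le h2 ?_
  rw [hB.measure_eq_iSup_isCompact]
  exact iSup₂_le fun K' hKB => iSup_le fun hK' =>
    ENNReal.le_sub_of_add_le_left (ne_top_of_le_ne_top hC h2) (h1 K' hKB hK')

/-- Layer-cake formula and Brunn–Minkowski on the superlevel sets. Equal suprema matter: for t < 1
both sets {u > t} and {v > t} are nonempty, and for t ≥ 1 both are empty. -/
theorem lintegral_add_lintegral_le_of_iSup_eq_one {u v w : ℝ → ℝ} (hu : Measurable u)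
    (hv : Measurable v) (hw : Measurable w) (hu0 : ∀ x, 0 ≤ u x) (hv0 : ∀ x, 0 ≤ v x)
    (hw0 : ∀ x, 0 ≤ w x) (hu1 : ∀ x, u x ≤ 1) (hv1 : ∀ x, v x ≤ 1)
    (hus : ∀ t < 1, ∃ x, t < u x) (hvs : ∀ t < 1, ∃ x, t < v x)
    (h : ∀ x y, u x * v y ≤ w ((x + y) / 2) ^ 2) :
    (∫⁻ x, ENNReal.ofReal (u x)) + ∫⁻ x, ENNReal.ofReal (v x) ≤
      2 * ∫⁻ x, ENNReal.ofReal (w x) := by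
  have meas : ∀ f : ℝ → ℝ, Measurable fun t => volume {x | t < f x} := fun f =>
    Antitone.measurable fun s t hst => measure_mono fun x (hx : t < f x) => lt_of_le_of_lt hst hx
  rw [lintegral_eq_lintegral_meas_lt _ (.of_forall hu0) hu.aemeasurable,
    lintegral_eq_lintegral_meas_lt _ (.of_forall hv0) hv.aemeasurable,
    lintegral_eq_lintegral_meas_lt _ (.of_forall hw0) hw.aemeasurable,
    ← lintegral_add_left (meas u), ← lintegral_const_mul _ (meas w)]
  refine setLIntegral_mono ((meas w).const_mul 2) fun t (ht : 0 < t) => ?_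
  rcases lt_or_ge t 1 with ht1 | ht1
  · refine volume_add_volume_le_of_midpoint_mem (measurableSet_lt measurable_const hu)
      (measurableSet_lt measurable_const hv) (hus t ht1) (hvs t ht1) fun x hx y hy => ?_
    refine lt_of_pow_lt_pow_left₀ 2 (hw0 _) (lt_of_lt_of_le ?_ (h x y))
    have hx' : t < u x := hx
    have hy' : t < v y := hy
    nlinarith
  · have h1 : {x | t < u x} = ∅ := by ext x; simpa using (hu1 x).trans ht1
    have h2 : {x | t < v x} = ∅ := by ext x; simpa using (hv1 x).trans ht1
    simp [h1, h2]

theorem lintegral_mul_lintegral_le_sq_of_add_le {a b c : ENNReal} (h : a + b ≤ 2 * c) :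
    a * b ≤ c ^ 2 := by
  have h1 : 4 * (a * b) ≤ 4 * c ^ 2 := by
    calc 4 * (a * b) = 4 * a * b := by ring
      _ ≤ (a + b) ^ 2 := by
        rcases le_total a b with hab | hab <;> obtain ⟨t, rfl⟩ := le_iff_exists_add.1 hab
        · exact (le_self_add (b := t ^ 2)).trans (le_of_eq (by ring))
        · exact (le_self_add (b := t ^ 2)).trans (le_of_eq (by ring))
      _ ≤ (2 * c) ^ 2 := by gcongr
      _ = 4 * c ^ 2 := by ring
  exact (ENNReal.mul_le_mul_iff_right (by norm_num) (by norm_num)).1 h1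

/-- Dividing u, v, w by sup u, sup v and √(sup u · sup v) preserves the hypothesis and normalizes
the suprema; the additive inequality then gives the product form by AM–GM. -/
theorem prekopa_leindler_real_of_bddAbove {u v w : ℝ → ℝ} (hu : Measurable u)
    (hv : Measurable v) (hw : Measurable w) (hu0 : ∀ x, 0 ≤ u x) (hv0 : ∀ x, 0 ≤ v x)
    (hw0 : ∀ x, 0 ≤ w x) (hub : BddAbove (Set.range u)) (hvb : BddAbove (Set.range v))
    (h : ∀ x y, u x * v y ≤ w ((x + y) / 2) ^ 2) :
    (∫⁻ x, ENNReal.ofReal (u x)) * ∫⁻ x, ENNReal.ofReal (v x) ≤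
      (∫⁻ x, ENNReal.ofReal (w x)) ^ 2 := by
  set a := ⨆ x, u x
  set b := ⨆ x, v x
  have ha : ∀ x, u x ≤ a := le_ciSup hub
  have hb : ∀ x, v x ≤ b := le_ciSup hvb
  rcases (le_trans (hu0 0) (ha 0)).eq_or_lt with ha0 | ha0
  · have : ∀ x, u x = 0 := fun x => le_antisymm (ha0 ▸ ha x) (hu0 x)
    simp [this]
  rcases (le_trans (hv0 0) (hb 0)).eq_or_lt with hb0 | hb0
  · have : ∀ x, v x = 0 := fun x => le_antisymm (hb0 ▸ hb x) (hv0 x)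
    simp [this]
  have hs : 0 < √(a * b) := Real.sqrt_pos.2 (mul_pos ha0 hb0)
  have key := lintegral_mul_lintegral_le_sq_of_add_le <|
    lintegral_add_lintegral_le_of_iSup_eq_one (u := fun x => u x / a) (v := fun x => v x / b)
      (w := fun x => w x / √(a * b)) (hu.div_const a) (hv.div_const b) (hw.div_const _)
      (fun x => div_nonneg (hu0 x) ha0.le) (fun x => div_nonneg (hv0 x) hb0.le)
      (fun x => div_nonneg (hw0 x) hs.le) (fun x => (div_le_one ha0).2 (ha x))
      (fun x => (div_le_one hb0).2 (hb x))
      (fun t ht => by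
        obtain ⟨x, hx⟩ := exists_lt_of_lt_ciSup (show t * a < ⨆ x, u x by
          change t * a < a
          nlinarith)
        exact ⟨x, (lt_div_iff₀ ha0).2 hx⟩)
      (fun t ht => by
        obtain ⟨x, hx⟩ := exists_lt_of_lt_ciSup (show t * b < ⨆ x, v x by
          change t * b < b
          nlinarith)
        exact ⟨x, (lt_div_iff₀ hb0).2 hx⟩)
      (fun x y => by
        rw [div_pow, Real.sq_sqrt (mul_pos ha0 hb0).le, div_mul_div_comm]
        exact div_le_div_of_nonneg_right (h x y) (mul_pos ha0 hb0).le)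
  have scale : ∀ (f : ℝ → ℝ) (c : ℝ), Measurable f → 0 < c →
      ∫⁻ x, ENNReal.ofReal (f x) = ENNReal.ofReal c * ∫⁻ x, ENNReal.ofReal (f x / c) := by
    intro f c hf hc
    rw [← lintegral_const_mul _ (hf.div_const c).ennreal_ofReal]
    congr 1 with x
    rw [← ENNReal.ofReal_mul hc.le, mul_div_cancel₀ _ hc.ne']
  rw [scale u a hu ha0, scale v b hv hb0, scale w _ hw hs]
  calc _ = ENNReal.ofReal a * ENNReal.ofReal b *
        ((∫⁻ x, ENNReal.ofReal (u x / a)) * ∫⁻ x, ENNReal.ofReal (v x / b)) := by ring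
    _ ≤ ENNReal.ofReal a * ENNReal.ofReal b *
        (∫⁻ x, ENNReal.ofReal (w x / √(a * b))) ^ 2 := by gcongr
    _ = _ := by
        rw [mul_pow, ← ENNReal.ofReal_pow hs.le, Real.sq_sqrt (mul_pos ha0 hb0).le,
          ENNReal.ofReal_mul ha0.le]

theorem tendsto_lintegral_min_natCast {α : Type*} [MeasurableSpace α] (μ : Measure α)
    {f : α → ENNReal} (hf : Measurable f) :
    Filter.Tendsto (fun n : ℕ => ∫⁻ x, min (f x) n ∂μ) Filter.atTop (nhds (∫⁻ x, f x ∂μ)) := by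
  refine lintegral_tendsto_of_tendsto_of_monotone
    (fun n => (hf.min measurable_const).aemeasurable)
    (.of_forall fun x m n hmn => min_le_min le_rfl (by exact_mod_cast hmn))
    (.of_forall fun x => ?_)
  have : Filter.Tendsto (fun n : ℕ => min (f x) (n : ENNReal)) Filter.atTop
      (nhds (min (f x) ⊤)) := tendsto_const_nhds.min ENNReal.tendsto_nat_nhds_top
  simpa using this

theorem prekopa_leindler_real {u v w : ℝ → ENNReal} (hu : Measurable u)
    (hv : Measurable v) (hw : Measurable w) (h : ∀ x y, u x * v y ≤ w ((x + y) / 2) ^ 2) :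
    (∫⁻ x, u x) * ∫⁻ x, v x ≤ (∫⁻ x, w x) ^ 2 := by
  by_cases hu0 : ∫⁻ x, u x = 0
  · simp [hu0]
  by_cases hv0 : ∫⁻ x, v x = 0
  · simp [hv0]
  -- Truncation at height n preserves the hypothesis. Vanishing integrals were set aside because
  -- multiplication in `ENNReal` is discontinuous at (0, ⊤).
  refine le_of_tendsto (ENNReal.Tendsto.mul (tendsto_lintegral_min_natCast _ hu) (.inl hu0)
    (tendsto_lintegral_min_natCast _ hv) (.inl hv0)) (.of_forall fun n => ?_)
  have fin : ∀ (f : ℝ → ENNReal) x, min (f x) (n : ENNReal) ≠ ⊤ := fun f x =>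
    ne_top_of_le_ne_top (ENNReal.natCast_ne_top n) (min_le_right _ _)
  have eq : ∀ f : ℝ → ENNReal, ∫⁻ x, min (f x) (n : ENNReal) =
      ∫⁻ x, ENNReal.ofReal (min (f x) (n : ENNReal)).toReal := fun f => by
    simp_rw [ENNReal.ofReal_toReal (fin f _)]
  have bdd : ∀ f : ℝ → ENNReal,
      BddAbove (Set.range fun x => (min (f x) (n : ENNReal)).toReal) := fun f =>
    ⟨n, by
      rintro _ ⟨x, rfl⟩
      exact ENNReal.toReal_le_of_le_ofReal (Nat.cast_nonneg n) (by simp)⟩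
  have meas : ∀ f : ℝ → ENNReal, Measurable f →
      Measurable fun x => (min (f x) (n : ENNReal)).toReal := fun f hf =>
    (hf.min measurable_const).ennreal_toReal
  calc (∫⁻ x, min (u x) n) * ∫⁻ x, min (v x) n ≤ (∫⁻ x, min (w x) n) ^ 2 := by
        rw [eq u, eq v, eq w]
        refine prekopa_leindler_real_of_bddAbove (meas u hu) (meas v hv) (meas w hw)
          (fun _ => ENNReal.toReal_nonneg) (fun _ => ENNReal.toReal_nonneg)
          (fun _ => ENNReal.toReal_nonneg) (bdd u) (bdd v) fun x y => ?_
        rw [← ENNReal.toReal_mul, ← ENNReal.toReal_pow]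
        refine ENNReal.toReal_mono (ENNReal.pow_ne_top (fin w _)) ?_
        rcases le_total (w ((x + y) / 2)) n with hn | hn
        · rw [min_eq_left hn]
          exact le_trans (mul_le_mul' (min_le_left _ _) (min_le_left _ _)) (h x y)
        · rw [min_eq_right hn, sq]
          exact mul_le_mul' (min_le_right _ _) (min_le_right _ _)
    _ ≤ (∫⁻ x, w x) ^ 2 := by
        gcongr
        exact min_le_left _ _

/-- Induction on the dimension: the inequality in dimension n, applied to the sections, is the
hypothesis of the one-dimensional case for the section integrals. -/
theorem prekopa_leindler_pi : ∀ (n : ℕ) {u v w : (Fin n → ℝ) → ENNReal}, Measurable u →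
    Measurable v → Measurable w → (∀ x y, u x * v y ≤ w ((1 / 2 : ℝ) • (x + y)) ^ 2) →
    (∫⁻ x, u x) * ∫⁻ x, v x ≤ (∫⁻ x, w x) ^ 2
  | 0, u, v, w, _, _, _, h => by
    have key : ∀ f : (Fin 0 → ℝ) → ENNReal, ∫⁻ x, f x = f 0 := fun f => by
      rw [lintegral_unique]
      simp only [volume_pi, Measure.pi_univ, Finset.univ_eq_empty, Finset.prod_empty, mul_one]
      exact congrArg f (Subsingleton.elim _ _)
    simpa [key] using h 0 0
  | n + 1, u, v, w, hu, hv, hw, h => by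
    have mp := (volume_preserving_piFinSuccAbove (fun _ : Fin (n + 1) => ℝ) 0).symm
    have happ : ∀ z : ℝ × (Fin n → ℝ),
        (MeasurableEquiv.piFinSuccAbove (fun _ : Fin (n + 1) => ℝ) 0).symm z =
          (Fin.cons z.1 z.2 : Fin (n + 1) → ℝ) := fun z => by
      simp [MeasurableEquiv.piFinSuccAbove_symm_apply, Fin.insertNthEquiv]
    have cons_meas : Measurable fun z : ℝ × (Fin n → ℝ) =>
        (Fin.cons z.1 z.2 : Fin (n + 1) → ℝ) := by
      rw [← funext happ]
      exact mp.measurable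
    have key : ∀ f : (Fin (n + 1) → ℝ) → ENNReal, Measurable f →
        ∫⁻ x, f x = ∫⁻ s : ℝ, ∫⁻ y : Fin n → ℝ, f (Fin.cons s y) := fun f hf => by
      rw [← mp.lintegral_comp hf]
      simp_rw [happ]
      exact lintegral_prod (fun z : ℝ × (Fin n → ℝ) => f (Fin.cons z.1 z.2))
        (hf.comp cons_meas).aemeasurable
    have meas : ∀ f : (Fin (n + 1) → ℝ) → ENNReal, Measurable f →
        Measurable fun s : ℝ => ∫⁻ y : Fin n → ℝ, f (Fin.cons s y) := fun f hf =>
      (hf.comp cons_meas).lintegral_prod_right'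
    have sect : ∀ (f : (Fin (n + 1) → ℝ) → ENNReal) (s : ℝ), Measurable f →
        Measurable fun y : Fin n → ℝ => f (Fin.cons s y) := fun f s hf =>
      (hf.comp cons_meas).comp measurable_prodMk_left
    rw [key u hu, key v hv, key w hw]
    refine prekopa_leindler_real (meas u hu) (meas v hv) (meas w hw) fun s t => ?_
    refine prekopa_leindler_pi n (sect u s hu) (sect v t hv) (sect w _ hw) fun x y => ?_
    convert h (Fin.cons s x) (Fin.cons t y) using 3
    ext i
    refine Fin.cases ?_ (fun j => ?_) i <;> simp <;> ring

theorem prekopa_leindler_euclideanSpace {n : ℕ} {u v w : EuclideanSpace ℝ (Fin n) → ENNReal}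
    (hu : Measurable u) (hv : Measurable v) (hw : Measurable w)
    (h : ∀ x y, u x * v y ≤ w ((1 / 2 : ℝ) • (x + y)) ^ 2) :
    (∫⁻ x, u x) * ∫⁻ x, v x ≤ (∫⁻ x, w x) ^ 2 := by
  have mp := PiLp.volume_preserving_toLp (Fin n)
  rw [← mp.lintegral_comp hu, ← mp.lintegral_comp hv, ← mp.lintegral_comp hw]
  exact prekopa_leindler_pi n (hu.comp mp.measurable) (hv.comp mp.measurable)
    (hw.comp mp.measurable) fun x y => h _ _

/-! ### Lipschitz functions and two elementary inequalities -/

/-- `f` is Lipschitz with the real constant `L`. -/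
def LipBound {E : Type*} [NormedAddCommGroup E] (L : ℝ) (f : E → ℝ) : Prop :=
  ∀ x y, |f x - f y| ≤ L * ‖x - y‖

namespace LipBound

variable {E : Type*} [NormedAddCommGroup E] {L K : ℝ} {f g : E → ℝ}

theorem mono (hf : LipBound L f) (h : L ≤ K) : LipBound K f := fun x y =>
  (hf x y).trans (mul_le_mul_of_nonneg_right h (norm_nonneg _))

theorem const_mul (hf : LipBound L f) (c : ℝ) : LipBound (|c| * L) fun x => c * f x :=
  fun x y => by
    rw [← mul_sub, abs_mul, mul_assoc]
    exact mul_le_mul_of_nonneg_left (hf x y) (abs_nonneg c)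

theorem sub_const (hf : LipBound L f) (c : ℝ) : LipBound L fun x => f x - c := fun x y => by
  simpa using hf x y

theorem add (hf : LipBound L f) (hg : LipBound K g) : LipBound (L + K) fun x => f x + g x :=
  fun x y => by
    rw [add_sub_add_comm, add_mul]
    exact (abs_add_le _ _).trans (add_le_add (hf x y) (hg x y))

theorem lipschitzWith (hf : LipBound L f) : LipschitzWith L.toNNReal f :=
  LipschitzWith.of_dist_le_mul fun x y => by
    rw [Real.dist_eq, dist_eq_norm]
    exact (hf x y).trans (mul_le_mul_of_nonneg_right (Real.le_coe_toNNReal L) (norm_nonneg _))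

theorem continuous (hf : LipBound L f) : Continuous f := hf.lipschitzWith.continuous

theorem abs_le (hf : LipBound L f) (x : E) : |f x| ≤ |f 0| + L * ‖x‖ := by
  have h := hf x 0
  rw [sub_zero] at h
  have := abs_sub_abs_le_abs_sub (f x) (f 0)
  linarith

end LipBound

/-- Cauchy–Schwarz, from the discriminant of t ↦ ∫ (at + b)². -/
theorem integral_mul_sq_le {α : Type*} [MeasurableSpace α] {μ : Measure α} {a b : α → ℝ}
    (ha : Integrable (fun x => a x ^ 2) μ) (hb : Integrable (fun x => b x ^ 2) μ)
    (hab : Integrable (fun x => a x * b x) μ) :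
    (∫ x, a x * b x ∂μ) ^ 2 ≤ (∫ x, a x ^ 2 ∂μ) * ∫ x, b x ^ 2 ∂μ := by
  have key : ∀ t : ℝ, 0 ≤ (∫ x, a x ^ 2 ∂μ) * (t * t) + (2 * ∫ x, a x * b x ∂μ) * t +
      ∫ x, b x ^ 2 ∂μ := fun t => by
    have h : ∫ x, (a x * t + b x) ^ 2 ∂μ = (∫ x, a x ^ 2 ∂μ) * (t * t) +
        (2 * ∫ x, a x * b x ∂μ) * t + ∫ x, b x ^ 2 ∂μ := by
      rw [← integral_mul_const, ← integral_const_mul, ← integral_mul_const,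
        ← integral_add (ha.mul_const _) ((hab.const_mul _).mul_const _),
        ← integral_add (by exact (ha.mul_const _).add ((hab.const_mul _).mul_const _)) hb]
      congr 1 with x
      ring
    rw [← h]
    exact integral_nonneg fun x => sq_nonneg _
  have := discrim_le_zero key
  rw [discrim] at this
  linarith

theorem one_add_le_cosh (t : ℝ) :
    1 + t ^ 2 / 2 + t ^ 4 / 24 + t ^ 6 / 720 ≤ Real.cosh t := by
  have h := sum_le_hasSum (Finset.range 4) (fun i _ => by
    rw [pow_mul]; positivity) (Real.hasSum_cosh t)
  simp only [Finset.sum_range_succ, Finset.sum_range_zero] at h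
  norm_num [Nat.factorial] at h
  linarith

/-! ### Concentration and moment bounds -/

/-- Product form of Gaussian concentration of Lipschitz functions under `μ`, with the constant
of a `c`-strongly log-concave measure. -/
def LipschitzConcentration {E : Type*} [NormedAddCommGroup E] [MeasurableSpace E] (c : ℝ)
    (μ : Measure E) : Prop :=
  ∀ (f : E → ℝ) (L : ℝ), LipBound L f →
    (∫⁻ x, ENNReal.ofReal (Real.exp (f x)) ∂μ) * (∫⁻ x, ENNReal.ofReal (Real.exp (-f x)) ∂μ) ≤
      ENNReal.ofReal (Real.exp (L ^ 2 / c))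

namespace LipschitzConcentration

section

variable {E : Type*} [NormedAddCommGroup E] [MeasurableSpace E] [BorelSpace E] {c : ℝ}
  {μ : Measure E} [IsProbabilityMeasure μ] {f g g' : E → ℝ} {L K : ℝ}

/-- The product of the two exponential integrals is finite and the other factor is nonzero, so this
factor is finite. -/
theorem integrable_exp (hμ : LipschitzConcentration c μ) (hf : LipBound L f) :
    Integrable (fun x => Real.exp (f x)) μ := by
  have hm : Measurable fun x => Real.exp (f x) := (Real.continuous_exp.comp hf.continuous).measurable
  refine ⟨hm.aestronglyMeasurable, ?_⟩
  rw [hasFiniteIntegral_iff_ofReal (.of_forall fun x => (Real.exp_pos _).le)]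
  have hm' : Measurable fun x => ENNReal.ofReal (Real.exp (-f x)) :=
    (Real.continuous_exp.comp hf.continuous.neg).measurable.ennreal_ofReal
  have h0 : ∫⁻ x, ENNReal.ofReal (Real.exp (-f x)) ∂μ ≠ 0 := by
    rw [Ne, lintegral_eq_zero_iff hm']
    intro h
    have h' : ∀ᵐ x ∂μ, False := h.mono fun x hx => by
      simp only [Pi.zero_apply, ENNReal.ofReal_eq_zero] at hx
      exact absurd hx (not_le.2 (Real.exp_pos _))
    have := (Filter.eventually_false_iff_eq_bot.1 h')
    exact IsProbabilityMeasure.ne_zero μ (ae_eq_bot.1 this)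
  refine lt_top_iff_ne_top.2 fun h => ?_
  have := hμ f L hf
  rw [h, ENNReal.top_mul h0] at this
  exact absurd (top_le_iff.1 this) ENNReal.ofReal_ne_top

theorem integrable_cosh (hμ : LipschitzConcentration c μ) (hf : LipBound L f) :
    Integrable (fun x => Real.cosh (f x)) μ := by
  have h1 := hμ.integrable_exp hf
  have h2 := hμ.integrable_exp (f := fun x => -f x) (L := L) fun x y => by
    simpa [neg_add_eq_sub, abs_sub_comm] using hf x y
  simp_rw [Real.cosh_eq]
  exact (h1.add h2).div_const 2

theorem integrable_pow (hμ : LipschitzConcentration c μ) (hf : LipBound L f) {n : ℕ}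
    (hn : n ≤ 4) : Integrable (fun x => f x ^ n) μ := by
  refine ((hμ.integrable_cosh hf).const_mul 24).mono'
    (hf.continuous.pow n).measurable.aestronglyMeasurable (.of_forall fun x => ?_)
  have h := one_add_le_cosh (f x)
  rw [norm_pow, Real.norm_eq_abs]
  have e2 : f x ^ 2 = |f x| ^ 2 := (sq_abs _).symm
  have e4 : f x ^ 4 = (|f x| ^ 2) ^ 2 := by rw [sq_abs]; ring
  have e6 : f x ^ 6 = (|f x| ^ 2) ^ 3 := by rw [sq_abs]; ring
  rw [e2, e4, e6] at h
  have h0 := abs_nonneg (f x)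
  have h6 : 0 ≤ (|f x| ^ 2) ^ 3 := by positivity
  generalize |f x| = a at *
  interval_cases n <;> nlinarith [sq_nonneg (a - 1), sq_nonneg (a ^ 2 - 1), sq_nonneg a,
    sq_nonneg (a ^ 2 - a)]

theorem integrable (hμ : LipschitzConcentration c μ) (hf : LipBound L f) : Integrable f μ := by
  simpa using hμ.integrable_pow hf (n := 1) (by norm_num)

/-- With A = ∫e^f and B = ∫e^(-f), mean zero gives A, B ≥ 1. Then (A - 1)(B - 1) ≥ 0 bounds A + B by
1 + AB. -/
theorem integral_cosh_le (hμ : LipschitzConcentration c μ) (hf : LipBound L f)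
    (hf0 : ∫ x, f x ∂μ = 0) :
    ∫ x, Real.cosh (f x) ∂μ ≤ 1 + (Real.exp (L ^ 2 / c) - 1) / 2 := by
  have hf' : LipBound L fun x => -f x := fun x y => by
    simpa [neg_add_eq_sub, abs_sub_comm] using hf x y
  have one_le : ∀ g : E → ℝ, LipBound L g → ∫ x, g x ∂μ = 0 →
      1 ≤ ∫ x, Real.exp (g x) ∂μ := fun g hg hg0 => by
    have : ∫ x, (g x + 1) ∂μ ≤ ∫ x, Real.exp (g x) ∂μ :=
      integral_mono ((hμ.integrable hg).add (integrable_const 1)) (hμ.integrable_exp hg)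
        fun x => Real.add_one_le_exp (g x)
    rw [integral_add (hμ.integrable hg) (integrable_const 1), hg0] at this
    simpa using this
  have h1 := one_le f hf hf0
  have h2 := one_le _ hf' (by rw [integral_neg, hf0, neg_zero])
  have h3 : (∫ x, Real.exp (f x) ∂μ) * ∫ x, Real.exp (-f x) ∂μ ≤ Real.exp (L ^ 2 / c) := by
    have h := hμ f L hf
    rw [← ofReal_integral_eq_lintegral_ofReal (hμ.integrable_exp hf)
      (.of_forall fun x => (Real.exp_pos _).le),
      ← ofReal_integral_eq_lintegral_ofReal (hμ.integrable_exp hf')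
      (.of_forall fun x => (Real.exp_pos _).le), ← ENNReal.ofReal_mul (by linarith)] at h
    exact (ENNReal.ofReal_le_ofReal_iff (Real.exp_pos _).le).1 h
  have h4 : ∫ x, Real.cosh (f x) ∂μ =
      ((∫ x, Real.exp (f x) ∂μ) + ∫ x, Real.exp (-f x) ∂μ) / 2 := by
    simp_rw [Real.cosh_eq]
    rw [integral_div, integral_add (hμ.integrable_exp hf) (hμ.integrable_exp hf')]
  rw [h4]
  nlinarith

theorem integral_sub_mean (hμ : LipschitzConcentration c μ) (hf : LipBound L f) :
    ∫ x, (f x - ∫ z, f z ∂μ) ∂μ = 0 := by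
  rw [integral_sub (hμ.integrable hf) (integrable_const _)]
  simp

/-- Poincaré inequality for Lipschitz functions. -/
theorem variance_le (hμ : LipschitzConcentration c μ) (hc : 0 < c) (hf : LipBound L f) :
    ∫ x, (f x - ∫ z, f z ∂μ) ^ 2 ∂μ ≤ L ^ 2 / c := by
  set F := fun x => f x - ∫ z, f z ∂μ
  have hF : LipBound L F := hf.sub_const _
  have hF0 : ∫ x, F x ∂μ = 0 := hμ.integral_sub_mean hf
  change ∫ x, F x ^ 2 ∂μ ≤ _
  set v := ∫ x, F x ^ 2 ∂μ
  -- Apply the cosh bound to √t·F and keep only the quadratic Taylor term. Both sides vanish at t =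
  -- 0, so comparing right derivatives there gives the sharp constant.
  have key : ∀ t : ℝ, 0 ≤ t → t * v ≤ Real.exp (t * (L ^ 2 / c)) - 1 := fun t ht => by
    have h1 : ∫ x, (1 + (√t * F x) ^ 2 / 2) ∂μ ≤ ∫ x, Real.cosh (√t * F x) ∂μ := by
      refine integral_mono ((integrable_const 1).add
        ((hμ.integrable_pow (hF.const_mul √t) (n := 2) (by norm_num)).div_const 2))
        (hμ.integrable_cosh (hF.const_mul √t)) fun x => ?_
      have := one_add_le_cosh (√t * F x)
      have h4 : 0 ≤ (√t * F x) ^ 4 := by positivity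
      have h6 : 0 ≤ (√t * F x) ^ 6 := by positivity
      change 1 + (√t * F x) ^ 2 / 2 ≤ Real.cosh (√t * F x)
      linarith
    have h2 := hμ.integral_cosh_le (hF.const_mul √t) (by rw [integral_const_mul, hF0, mul_zero])
    rw [integral_add (integrable_const 1)
      ((hμ.integrable_pow (hF.const_mul √t) (n := 2) (by norm_num)).div_const 2),
      integral_div] at h1
    simp_rw [mul_pow] at h1
    rw [integral_const_mul, Real.sq_sqrt ht] at h1
    rw [mul_pow, sq_abs, Real.sq_sqrt ht, mul_div_assoc] at h2
    simp only [integral_const, probReal_univ, smul_eq_mul, one_mul] at h1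
    change 1 + t * v / 2 ≤ _ at h1
    linarith
  by_contra hlt
  rw [not_le] at hlt
  set s := L ^ 2 / c
  have hs : 0 ≤ s := by positivity
  have hd : HasDerivAt (fun t => Real.exp (t * s) - 1 - t * v) (s - v) 0 := by
    have := (((hasDerivAt_id (0 : ℝ)).mul_const s).exp.sub_const 1).sub
      ((hasDerivAt_id (0 : ℝ)).mul_const v)
    exact this.congr_deriv (by simp)
  have := hd.tendsto_slope_zero_right
  have hge : 0 ≤ s - v := ge_of_tendsto this (by
    filter_upwards [self_mem_nhdsWithin] with t ht
    have ht' : (0 : ℝ) < t := ht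
    have := key t ht'.le
    simp only [zero_add, zero_mul, Real.exp_zero, sub_self, sub_zero, smul_eq_mul]
    exact mul_nonneg (inv_nonneg.2 ht'.le) (by linarith))
  linarith

theorem fourth_moment_le (hμ : LipschitzConcentration c μ) (hc : 0 < c) (hf : LipBound 1 f) :
    ∫ x, (f x - ∫ z, f z ∂μ) ^ 4 ∂μ ≤ 16 / c ^ 2 := by
  set F := fun x => f x - ∫ z, f z ∂μ
  have hF : LipBound 1 F := hf.sub_const _
  have hF0 : ∫ x, F x ∂μ = 0 := hμ.integral_sub_mean hf
  change ∫ x, F x ^ 4 ∂μ ≤ _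
  have hG := hF.const_mul √(2 * c)
  -- The scale √(2c) makes the exponent L²/c equal to 2.
  have hI := hμ.integrable_pow hG (n := 4) le_rfl
  have h2 := hμ.integral_cosh_le hG (by rw [integral_const_mul, hF0, mul_zero])
  have h1 : ∫ x, (7 / 120 * (√(2 * c) * F x) ^ 4 + (1 - 16 / 45)) ∂μ ≤
      ∫ x, Real.cosh (√(2 * c) * F x) ∂μ := by
    refine integral_mono ((hI.const_mul _).add (integrable_const _))
      (hμ.integrable_cosh hG) fun x => ?_
    have h := one_add_le_cosh (√(2 * c) * F x)
    change 7 / 120 * (√(2 * c) * F x) ^ 4 + (1 - 16 / 45) ≤ Real.cosh (√(2 * c) * F x)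
    generalize √(2 * c) * F x = t at *
    -- The sextic Taylor polynomial minus 7t⁴/120 + 1 - 16/45 equals ((t² - 8)²(t² + 4) +
    -- 360t²)/720.
    have : 0 ≤ (t ^ 2 - 8) ^ 2 * (t ^ 2 + 4) := by positivity
    nlinarith [sq_nonneg t]
  rw [integral_add (hI.const_mul _) (integrable_const _), integral_const_mul] at h1
  simp_rw [mul_pow] at h1
  have e4 : √(2 * c) ^ 4 = 4 * c ^ 2 := by
    calc √(2 * c) ^ 4 = (√(2 * c) ^ 2) ^ 2 := by ring
      _ = 4 * c ^ 2 := by rw [Real.sq_sqrt (by positivity)]; ring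
  have e2 : (|√(2 * c)| * 1) ^ 2 / c = 2 := by
    rw [mul_one, sq_abs, Real.sq_sqrt (by positivity)]
    field_simp
  rw [integral_const_mul, e4] at h1
  rw [e2] at h2
  simp only [integral_const, probReal_univ, smul_eq_mul, one_mul] at h1
  have hexp : Real.exp 2 ≤ 7.4 := by
    have h := Real.exp_one_lt_d9
    have : Real.exp 2 = Real.exp 1 ^ 2 := by rw [← Real.exp_nat_mul]; norm_num
    rw [this]
    nlinarith [Real.exp_pos 1]
  rw [le_div_iff₀ (by positivity)]
  nlinarith

theorem integrable_mul (hμ : LipschitzConcentration c μ) (hf : LipBound L f)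
    (hg : LipBound K g) : Integrable (fun x => f x * g x) μ := by
  refine ((hμ.integrable_pow hf (n := 2) (by norm_num)).add
    (hμ.integrable_pow hg (n := 2) (by norm_num))).mono'
    (hf.continuous.mul hg.continuous).measurable.aestronglyMeasurable (.of_forall fun x => ?_)
  rw [Real.norm_eq_abs, Pi.add_apply, abs_le]
  constructor <;> nlinarith [sq_nonneg (f x + g x), sq_nonneg (f x - g x), sq_nonneg (f x),
    sq_nonneg (g x)]

theorem abs_covariance_le (hμ : LipschitzConcentration c μ) (hc : 0 < c) (hL : 0 ≤ L)
    (hK : 0 ≤ K) (hf : LipBound L f) (hg : LipBound K g) :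
    |∫ x, (f x - ∫ z, f z ∂μ) * (g x - ∫ z, g z ∂μ) ∂μ| ≤ L * K / c := by
  have hf' := hf.sub_const (∫ z, f z ∂μ)
  have hg' := hg.sub_const (∫ z, g z ∂μ)
  refine abs_le_of_sq_le_sq ?_ (by positivity)
  refine (integral_mul_sq_le (hμ.integrable_pow hf' (by norm_num))
    (hμ.integrable_pow hg' (by norm_num)) (hμ.integrable_mul hf' hg')).trans ?_
  calc _ ≤ L ^ 2 / c * (K ^ 2 / c) := mul_le_mul (hμ.variance_le hc hf) (hμ.variance_le hc hg)
        (integral_nonneg fun x => sq_nonneg _) (by positivity)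
    _ = (L * K / c) ^ 2 := by ring

theorem integrable_mul_mul (hμ : LipschitzConcentration c μ) (hf : LipBound L f)
    (hg : LipBound 1 g) (hg' : LipBound 1 g') : Integrable (fun x => f x * (g x * g' x)) μ := by
  refine ((hμ.integrable_pow hf (n := 2) (by norm_num)).add
    ((hμ.integrable_pow hg (n := 4) (by norm_num)).add
      (hμ.integrable_pow hg' (n := 4) (by norm_num)))).mono'
    (hf.continuous.mul (hg.continuous.mul hg'.continuous)).measurable.aestronglyMeasurable
    (.of_forall fun x => ?_)
  rw [Real.norm_eq_abs, Pi.add_apply, Pi.add_apply, abs_le]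
  constructor <;> nlinarith [sq_nonneg (f x + g x * g' x), sq_nonneg (f x - g x * g' x),
    sq_nonneg (f x), sq_nonneg (g x ^ 2), sq_nonneg (g' x ^ 2), sq_nonneg (g x ^ 2 - g' x ^ 2)]

/-- Cauchy–Schwarz separates f from the product of the other two factors; (ab)² ≤ (a⁴ + b⁴)/2
reduces that product to fourth moments. -/
theorem sq_third_cumulant_le (hμ : LipschitzConcentration c μ) (hc : 0 < c)
    (hf : LipBound L f) (hg : LipBound 1 g) (hg' : LipBound 1 g') :
    (∫ x, (f x - ∫ z, f z ∂μ) * ((g x - ∫ z, g z ∂μ) * (g' x - ∫ z, g' z ∂μ)) ∂μ) ^ 2 ≤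
      16 * L ^ 2 / c ^ 3 := by
  have hF := hf.sub_const (∫ z, f z ∂μ)
  have hG := hg.sub_const (∫ z, g z ∂μ)
  have hG' := hg'.sub_const (∫ z, g' z ∂μ)
  have h4 := hμ.integrable_pow hG (n := 4) le_rfl
  have h4' := hμ.integrable_pow hG' (n := 4) le_rfl
  have hle : ∀ a b : ℝ, (a * b) ^ 2 ≤ (a ^ 4 + b ^ 4) / 2 := fun a b => by
    nlinarith [sq_nonneg (a ^ 2 - b ^ 2)]
  have hI : Integrable (fun x => ((g x - ∫ z, g z ∂μ) * (g' x - ∫ z, g' z ∂μ)) ^ 2) μ := by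
    refine ((h4.add h4').div_const 2).mono'
      ((hG.continuous.mul hG'.continuous).pow 2).measurable.aestronglyMeasurable
      (.of_forall fun x => ?_)
    rw [Real.norm_eq_abs, abs_of_nonneg (sq_nonneg _)]
    exact hle _ _
  have hm : ∫ x, ((g x - ∫ z, g z ∂μ) * (g' x - ∫ z, g' z ∂μ)) ^ 2 ∂μ ≤ 16 / c ^ 2 := by
    refine (integral_mono hI ((h4.add h4').div_const 2) fun x => hle _ _).trans ?_
    rw [integral_div, integral_add' h4 h4']
    linarith [hμ.fourth_moment_le hc hg, hμ.fourth_moment_le hc hg']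
  refine (integral_mul_sq_le (hμ.integrable_pow hF (by norm_num)) hI
    (hμ.integrable_mul_mul hF hG hG')).trans ?_
  calc _ ≤ L ^ 2 / c * (16 / c ^ 2) := mul_le_mul (hμ.variance_le hc hf) hm
        (integral_nonneg fun x => sq_nonneg _) (by positivity)
    _ = 16 * L ^ 2 / c ^ 3 := by field_simp

end

/-- A probability measure with a strongly log-concave density, in midpoint form, satisfies the
concentration inequality. -/
theorem of_midpoint {d : ℕ} {c : ℝ} (hc : 0 < c) {r : EuclideanSpace ℝ (Fin d) → ℝ}
    (hr : Measurable r) (hr0 : ∀ x, 0 ≤ r x)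
    (hmid : ∀ x y, r x * r y ≤ r ((1 / 2 : ℝ) • (x + y)) ^ 2 * Real.exp (-(c / 4) * ‖x - y‖ ^ 2))
    [IsProbabilityMeasure (volume.withDensity fun x => ENNReal.ofReal (r x))] :
    LipschitzConcentration c (volume.withDensity fun x => ENNReal.ofReal (r x)) := by
  intro f L hf
  have hf' : Measurable f := hf.continuous.measurable
  have huniv : ∫⁻ x, ENNReal.ofReal (r x) = 1 := by
    have := measure_univ (μ := volume.withDensity fun x => ENNReal.ofReal (r x))
    rwa [withDensity_apply _ MeasurableSet.univ, Measure.restrict_univ] at this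
  -- Prékopa–Leindler for r e^f, r e^(-f) and r e^(L²/(2c)): the Gaussian gain in the midpoint
  -- inequality pays for f(x) - f(y) ≤ L‖x - y‖, since Ls - cs²/4 ≤ L²/c.
  have key := prekopa_leindler_euclideanSpace (u := fun x => ENNReal.ofReal (r x * Real.exp (f x)))
    (v := fun x => ENNReal.ofReal (r x * Real.exp (-f x)))
    (w := fun x => ENNReal.ofReal (Real.exp (L ^ 2 / c / 2)) * ENNReal.ofReal (r x))
    (by fun_prop) (by fun_prop) (by fun_prop) (fun x y => by
      rw [← ENNReal.ofReal_mul (mul_nonneg (hr0 _) (Real.exp_pos _).le),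
        ← ENNReal.ofReal_mul (Real.exp_pos _).le,
        ← ENNReal.ofReal_pow (mul_nonneg (Real.exp_pos _).le (hr0 _))]
      refine ENNReal.ofReal_le_ofReal ?_
      have h1 : f x - f y - c / 4 * ‖x - y‖ ^ 2 ≤ L ^ 2 / c := by
        have h2 := (le_abs_self _).trans (hf x y)
        have h3 : L * ‖x - y‖ - c / 4 * ‖x - y‖ ^ 2 ≤ L ^ 2 / c := by
          rw [le_div_iff₀ hc]
          nlinarith [sq_nonneg (L - c / 2 * ‖x - y‖)]
        linarith
      calc r x * Real.exp (f x) * (r y * Real.exp (-f y))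
          = r x * r y * Real.exp (f x - f y) := by rw [sub_eq_add_neg, Real.exp_add]; ring
        _ ≤ r ((1 / 2 : ℝ) • (x + y)) ^ 2 * Real.exp (-(c / 4) * ‖x - y‖ ^ 2) *
            Real.exp (f x - f y) :=
          mul_le_mul_of_nonneg_right (hmid x y) (Real.exp_pos _).le
        _ = r ((1 / 2 : ℝ) • (x + y)) ^ 2 * Real.exp (f x - f y - c / 4 * ‖x - y‖ ^ 2) := by
            rw [mul_assoc, ← Real.exp_add]
            congr 2
            ring
        _ ≤ r ((1 / 2 : ℝ) • (x + y)) ^ 2 * Real.exp (L ^ 2 / c) := by gcongr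
        _ = (Real.exp (L ^ 2 / c / 2) * r ((1 / 2 : ℝ) • (x + y))) ^ 2 := by
            rw [mul_pow, ← Real.exp_nat_mul, mul_comm]
            congr 2
            push_cast
            ring)
  rw [lintegral_const_mul _ hr.ennreal_ofReal, huniv, mul_one,
    ← ENNReal.ofReal_pow (Real.exp_pos _).le, ← Real.exp_nat_mul] at key
  rw [lintegral_withDensity_eq_lintegral_mul _ (by fun_prop) (by fun_prop),
    lintegral_withDensity_eq_lintegral_mul _ (by fun_prop) (by fun_prop)]
  simp only [Pi.mul_apply, ← ENNReal.ofReal_mul (hr0 _)]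
  refine key.trans (le_of_eq ?_)
  congr 2
  push_cast
  ring

end LipschitzConcentration

/-! ### Exponential growth and Gaussian integrability -/

/-- `F` is measurable and grows at most exponentially. -/
def ExpGrowth {d : ℕ} (F : EuclideanSpace ℝ (Fin d) → ℝ) : Prop :=
  Measurable F ∧ ∃ A b : ℝ, 0 ≤ A ∧ 0 ≤ b ∧ ∀ y, |F y| ≤ A * Real.exp (b * ‖y‖)

namespace ExpGrowth

variable {d : ℕ} {F G : EuclideanSpace ℝ (Fin d) → ℝ}

theorem of_lipBound {L : ℝ} (hF : LipBound L F) : ExpGrowth F := by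
  refine ⟨hF.continuous.measurable, |F 0| + |L|, 1, by positivity, zero_le_one, fun y => ?_⟩
  have h1 := hF.abs_le y
  have h2 : L * ‖y‖ ≤ |L| * ‖y‖ := mul_le_mul_of_nonneg_right (le_abs_self L) (norm_nonneg y)
  have h3 := Real.add_one_le_exp ‖y‖
  have h4 := Real.one_le_exp (norm_nonneg y)
  rw [one_mul]
  nlinarith [abs_nonneg (F 0), abs_nonneg L]

theorem const (a : ℝ) : ExpGrowth fun _ : EuclideanSpace ℝ (Fin d) => a :=
  of_lipBound (L := 0) fun x y => by simp

theorem mul (hF : ExpGrowth F) (hG : ExpGrowth G) : ExpGrowth fun y => F y * G y := by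
  obtain ⟨hFm, A, b, hA, hb, h⟩ := hF
  obtain ⟨hGm, A', b', hA', hb', h'⟩ := hG
  refine ⟨hFm.mul hGm, A * A', b + b', by positivity, by positivity, fun y => ?_⟩
  rw [abs_mul, add_mul, Real.exp_add]
  calc _ ≤ A * Real.exp (b * ‖y‖) * (A' * Real.exp (b' * ‖y‖)) :=
        mul_le_mul (h y) (h' y) (abs_nonneg _) (by positivity)
    _ = _ := by ring

theorem add (hF : ExpGrowth F) (hG : ExpGrowth G) : ExpGrowth fun y => F y + G y := by
  obtain ⟨hFm, A, b, hA, hb, h⟩ := hF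
  obtain ⟨hGm, A', b', hA', hb', h'⟩ := hG
  refine ⟨hFm.add hGm, A + A', b + b', by positivity, by positivity, fun y => ?_⟩
  have e1 : Real.exp (b * ‖y‖) ≤ Real.exp ((b + b') * ‖y‖) :=
    Real.exp_le_exp.2 (by nlinarith [norm_nonneg y])
  have e2 : Real.exp (b' * ‖y‖) ≤ Real.exp ((b + b') * ‖y‖) :=
    Real.exp_le_exp.2 (by nlinarith [norm_nonneg y])
  calc |F y + G y| ≤ |F y| + |G y| := abs_add_le _ _
    _ ≤ A * Real.exp (b * ‖y‖) + A' * Real.exp (b' * ‖y‖) := add_le_add (h y) (h' y)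
    _ ≤ A * Real.exp ((b + b') * ‖y‖) + A' * Real.exp ((b + b') * ‖y‖) := by gcongr
    _ = _ := by ring

theorem sub_const (hF : ExpGrowth F) (a : ℝ) : ExpGrowth fun y => F y - a := by
  simpa [sub_eq_add_neg] using hF.add (const (-a))

theorem norm : ExpGrowth fun y : EuclideanSpace ℝ (Fin d) => ‖y‖ :=
  of_lipBound (L := 1) fun x y => by simpa using abs_norm_sub_norm_le x y

theorem inner_left (v : EuclideanSpace ℝ (Fin d)) : ExpGrowth fun y => inner ℝ v y :=
  of_lipBound (L := ‖v‖) fun x y => by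
    rw [← inner_sub_right]
    exact abs_real_inner_le_norm _ _

end ExpGrowth

theorem lipBound_inner_left {d : ℕ} (v : EuclideanSpace ℝ (Fin d)) :
    LipBound ‖v‖ fun y => inner ℝ v y := fun x y => by
  rw [← inner_sub_right]
  exact abs_real_inner_le_norm _ _

/-- Half of the Gaussian absorbs the linear term by completing the square. -/
theorem integrable_exp_mul_norm_sub_sq {d : ℕ} (b : ℝ) {δ : ℝ} (hδ : 0 < δ) :
    Integrable fun y : EuclideanSpace ℝ (Fin d) => Real.exp (b * ‖y‖ - δ * ‖y‖ ^ 2) := by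
  have h := (GaussianFourier.integrable_cexp_neg_mul_sq_norm_add
    (V := EuclideanSpace ℝ (Fin d)) (b := ((δ / 2 : ℝ) : ℂ)) (by simpa using hδ) 0 0).norm
  refine (h.const_mul (Real.exp (b ^ 2 / (2 * δ)))).mono' (by fun_prop) (.of_forall fun y => ?_)
  rw [Real.norm_eq_abs, abs_of_pos (Real.exp_pos _), Complex.norm_exp, ← Real.exp_add]
  refine Real.exp_le_exp.2 ?_
  have e : (-((δ / 2 : ℝ) : ℂ) * (‖y‖ : ℂ) ^ 2 + 0 * ((inner ℝ 0 y : ℝ) : ℂ)).re =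
      -(δ / 2) * ‖y‖ ^ 2 := by
    rw [zero_mul, add_zero, ← Complex.ofReal_neg, ← Complex.ofReal_pow, ← Complex.ofReal_mul,
      Complex.ofReal_re]
  rw [e]
  have : b ^ 2 / (2 * δ) - b * ‖y‖ + δ / 2 * ‖y‖ ^ 2 = (b - δ * ‖y‖) ^ 2 / (2 * δ) := by
    field_simp
    ring
  have h0 : 0 ≤ (b - δ * ‖y‖) ^ 2 / (2 * δ) := by positivity
  linarith

/-! ### The exponential family: concentration, derivatives, contraction -/

/-- Base density of an exponential family `exp (β ⟪x, y⟫) q y`: positive, with a Gaussian bound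
that beats `exp (-β ‖y‖² / 2)`, and `c`-strongly log-concave in midpoint form, with `β < c`. -/
structure IsTiltBase {d : ℕ} (β c : ℝ) (q : EuclideanSpace ℝ (Fin d) → ℝ) : Prop where
  beta_pos : 0 < β
  beta_lt : β < c
  measurable : Measurable q
  pos : ∀ x, 0 < q x
  bound : ∃ C δ : ℝ, 0 < δ ∧ ∀ x, q x ≤ C * Real.exp (-(β / 2 + δ) * ‖x‖ ^ 2)
  midpoint : ∀ x y, q x * q y ≤
    q ((1 / 2 : ℝ) • (x + y)) ^ 2 * Real.exp (-(c / 4) * ‖x - y‖ ^ 2)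

/-- `∫ exp (β ⟪x, y⟫) q(y) F(y) dy`. -/
noncomputable def tiltInt {d : ℕ} (β : ℝ) (q F : EuclideanSpace ℝ (Fin d) → ℝ)
    (x : EuclideanSpace ℝ (Fin d)) : ℝ :=
  ∫ y, Real.exp (β * inner ℝ x y) * q y * F y

/-- The normalizing constant of the exponential family. -/
noncomputable def tiltZ {d : ℕ} (β : ℝ) (q : EuclideanSpace ℝ (Fin d) → ℝ)
    (x : EuclideanSpace ℝ (Fin d)) : ℝ :=
  tiltInt β q (fun _ => 1) x

/-- The mean of `F` under the member `x` of the exponential family. -/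
noncomputable def tiltMean {d : ℕ} (β : ℝ) (q F : EuclideanSpace ℝ (Fin d) → ℝ)
    (x : EuclideanSpace ℝ (Fin d)) : ℝ :=
  tiltInt β q F x / tiltZ β q x

/-- The member `x` of the exponential family, as a measure. -/
noncomputable def tiltMeasure {d : ℕ} (β : ℝ) (q : EuclideanSpace ℝ (Fin d) → ℝ)
    (x : EuclideanSpace ℝ (Fin d)) : Measure (EuclideanSpace ℝ (Fin d)) :=
  volume.withDensity fun y =>
    ENNReal.ofReal (Real.exp (β * inner ℝ x y) * q y / tiltZ β q x)

namespace IsTiltBase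

variable {d : ℕ} {β c L : ℝ} {q F G : EuclideanSpace ℝ (Fin d) → ℝ}
  {x v : EuclideanSpace ℝ (Fin d)}

theorem integrable_exp_norm (hq : IsTiltBase β c q) (b : ℝ) :
    Integrable fun y => Real.exp (b * ‖y‖) * q y := by
  obtain ⟨C, δ, hδ, hC⟩ := hq.bound
  have hδ' : 0 < β / 2 + δ := by linarith [hq.beta_pos]
  refine ((integrable_exp_mul_norm_sub_sq b hδ').const_mul C).mono'
    (by have := hq.measurable; fun_prop) (.of_forall fun y => ?_)
  rw [Real.norm_eq_abs, abs_of_pos (mul_pos (Real.exp_pos _) (hq.pos y))]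
  calc _ ≤ Real.exp (b * ‖y‖) * (C * Real.exp (-(β / 2 + δ) * ‖y‖ ^ 2)) := by
        gcongr; exact hC y
    _ = _ := by rw [sub_eq_add_neg, Real.exp_add]; ring_nf

theorem exp_inner_le (hβ : 0 < β) {r : ℝ} (hx : ‖x‖ ≤ r) (y : EuclideanSpace ℝ (Fin d)) :
    Real.exp (β * inner ℝ x y) ≤ Real.exp (β * r * ‖y‖) := by
  refine Real.exp_le_exp.2 ?_
  rw [mul_assoc]
  refine mul_le_mul_of_nonneg_left ?_ hβ.le
  exact (real_inner_le_norm x y).trans (mul_le_mul_of_nonneg_right hx (norm_nonneg y))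

/-- A dominating function uniform for x in a ball, as needed to differentiate under the integral. -/
theorem exists_integrable_bound (hq : IsTiltBase β c q) (hF : ExpGrowth F) (r : ℝ) :
    ∃ g : EuclideanSpace ℝ (Fin d) → ℝ, Integrable g ∧
      ∀ x, ‖x‖ ≤ r → ∀ y, |Real.exp (β * inner ℝ x y) * q y * F y| ≤ g y := by
  obtain ⟨hFm, A, b, hA, hb, h⟩ := hF
  refine ⟨_, (hq.integrable_exp_norm (β * r + b)).const_mul A, fun x hx y => ?_⟩
  rw [abs_mul, abs_of_pos (mul_pos (Real.exp_pos _) (hq.pos y))]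
  have hqy := (hq.pos y).le
  calc _ ≤ Real.exp (β * r * ‖y‖) * q y * (A * Real.exp (b * ‖y‖)) := by
        refine mul_le_mul ?_ (h y) (abs_nonneg _) (by positivity)
        exact mul_le_mul_of_nonneg_right (exp_inner_le hq.beta_pos hx y) hqy
    _ = _ := by rw [add_mul, Real.exp_add]; ring

theorem integrable_tilt (hq : IsTiltBase β c q) (hF : ExpGrowth F)
    (x : EuclideanSpace ℝ (Fin d)) :
    Integrable fun y => Real.exp (β * inner ℝ x y) * q y * F y := by
  obtain ⟨g, hg, hle⟩ := hq.exists_integrable_bound hF ‖x‖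
  have h1 := hq.measurable
  have h2 := hF.1
  exact hg.mono' (by fun_prop) (.of_forall (hle x le_rfl))

theorem tiltZ_pos (hq : IsTiltBase β c q) (x : EuclideanSpace ℝ (Fin d)) :
    0 < tiltZ β q x := by
  have hpos : ∀ y, 0 < Real.exp (β * inner ℝ x y) * q y * 1 := fun y => by
    have := hq.pos y
    positivity
  rw [tiltZ, tiltInt, integral_pos_iff_support_of_nonneg (fun y => (hpos y).le)
    (hq.integrable_tilt (.const 1) x)]
  have : (Function.support fun y => Real.exp (β * inner ℝ x y) * q y * 1) = Set.univ :=
    Set.eq_univ_of_forall fun y => (hpos y).ne'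
  rw [this]
  exact (isOpen_univ.measure_pos volume Set.univ_nonempty)

theorem density_nonneg (hq : IsTiltBase β c q) (x y : EuclideanSpace ℝ (Fin d)) :
    0 ≤ Real.exp (β * inner ℝ x y) * q y / tiltZ β q x :=
  div_nonneg (mul_nonneg (Real.exp_pos _).le (hq.pos y).le) (hq.tiltZ_pos x).le

theorem measurable_density (hq : IsTiltBase β c q) (x : EuclideanSpace ℝ (Fin d)) :
    Measurable fun y => Real.exp (β * inner ℝ x y) * q y / tiltZ β q x := by
  have := hq.measurable
  fun_prop

theorem integrable_tiltMeasure_iff (hq : IsTiltBase β c q) :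
    Integrable F (tiltMeasure β q x) ↔
      Integrable fun y => Real.exp (β * inner ℝ x y) * q y * F y := by
  rw [tiltMeasure, integrable_withDensity_iff_integrable_smul'
    (hq.measurable_density x).ennreal_ofReal (.of_forall fun _ => ENNReal.ofReal_lt_top)]
  simp_rw [ENNReal.toReal_ofReal (hq.density_nonneg x _), smul_eq_mul, div_mul_eq_mul_div]
  have h0 := (hq.tiltZ_pos x).ne'
  refine ⟨fun h => ?_, fun h => h.div_const _⟩
  refine (h.mul_const (tiltZ β q x)).congr (.of_forall fun y => ?_)
  field_simp

theorem integral_tiltMeasure (hq : IsTiltBase β c q) :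
    ∫ y, F y ∂(tiltMeasure β q x) = tiltMean β q F x := by
  rw [tiltMeasure, integral_withDensity_eq_integral_toReal_smul
    (hq.measurable_density x).ennreal_ofReal (.of_forall fun _ => ENNReal.ofReal_lt_top)]
  simp_rw [ENNReal.toReal_ofReal (hq.density_nonneg x _), smul_eq_mul, div_mul_eq_mul_div]
  rw [integral_div]
  rfl

theorem isProbabilityMeasure (hq : IsTiltBase β c q) (x : EuclideanSpace ℝ (Fin d)) :
    IsProbabilityMeasure (tiltMeasure β q x) := by
  constructor
  rw [tiltMeasure, withDensity_apply _ MeasurableSet.univ, Measure.restrict_univ,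
    ← ofReal_integral_eq_lintegral_ofReal ?_ (.of_forall (hq.density_nonneg x)), integral_div]
  · have : tiltZ β q x = ∫ y, Real.exp (β * inner ℝ x y) * q y := by
      rw [tiltZ, tiltInt]
      simp_rw [mul_one]
    rw [← this, div_self (hq.tiltZ_pos x).ne', ENNReal.ofReal_one]
  · refine Integrable.div_const ?_ _
    simpa using hq.integrable_tilt (.const 1) x

/-- The tilt is log-affine in y, so it leaves the strong log-concavity constant of q unchanged. -/
theorem lipschitzConcentration (hq : IsTiltBase β c q) (x : EuclideanSpace ℝ (Fin d)) :
    LipschitzConcentration c (tiltMeasure β q x) := by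
  have := hq.isProbabilityMeasure x
  rw [tiltMeasure] at this ⊢
  refine LipschitzConcentration.of_midpoint (hq.beta_pos.trans hq.beta_lt)
    (hq.measurable_density x) (hq.density_nonneg x) fun y z => ?_
  have e : Real.exp (β * inner ℝ x y) * Real.exp (β * inner ℝ x z) =
      Real.exp (β * inner ℝ x ((1 / 2 : ℝ) • (y + z))) ^ 2 := by
    rw [← Real.exp_add, ← Real.exp_nat_mul, inner_smul_right, inner_add_right]
    congr 1
    push_cast
    ring
  have hZ := hq.tiltZ_pos x
  calc _ = Real.exp (β * inner ℝ x y) * Real.exp (β * inner ℝ x z) * (q y * q z) /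
        tiltZ β q x ^ 2 := by field_simp
    _ ≤ Real.exp (β * inner ℝ x y) * Real.exp (β * inner ℝ x z) *
        (q ((1 / 2 : ℝ) • (y + z)) ^ 2 * Real.exp (-(c / 4) * ‖y - z‖ ^ 2)) /
        tiltZ β q x ^ 2 :=
        div_le_div_of_nonneg_right
          (mul_le_mul_of_nonneg_left (hq.midpoint y z) (by positivity)) (by positivity)
    _ = _ := by rw [e]; field_simp

theorem hasFDerivAt_tiltInt (hq : IsTiltBase β c q) (hF : ExpGrowth F)
    (x : EuclideanSpace ℝ (Fin d)) :
    HasFDerivAt (tiltInt β q F)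
      (∫ y, (Real.exp (β * inner ℝ x y) * q y * F y) • (β • innerSL ℝ y)) x := by
  have hqm := hq.measurable
  have hFm := hF.1
  obtain ⟨g, hg, hle⟩ := hq.exists_integrable_bound ((hF.mul .norm).mul (.const β)) (‖x‖ + 1)
  refine hasFDerivAt_integral_of_dominated_of_fderiv_le (bound := g)
    (F := fun x y => Real.exp (β * inner ℝ x y) * q y * F y)
    (F' := fun x y => (Real.exp (β * inner ℝ x y) * q y * F y) • (β • innerSL ℝ y))
    (Metric.ball_mem_nhds x one_pos) (.of_forall fun z => (hq.integrable_tilt hF z).1)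
    (hq.integrable_tilt hF x) ?_ (.of_forall fun y z hz => ?_) hg
    (.of_forall fun y z _ => ?_)
  · refine (hq.integrable_tilt hF x).1.smul ?_
    have : Continuous fun y : EuclideanSpace ℝ (Fin d) => β • innerSL ℝ y := by fun_prop
    exact this.aestronglyMeasurable
  · have hz' : ‖z‖ ≤ ‖x‖ + 1 := by
      have h1 := norm_le_norm_add_norm_sub' z x
      rw [mem_ball_iff_norm] at hz
      linarith
    refine le_trans (le_of_eq ?_) (hle z hz' y)
    rw [norm_smul, norm_smul, innerSL_apply_norm, Real.norm_eq_abs, Real.norm_eq_abs, abs_mul,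
      abs_mul _ (F y * ‖y‖ * β), abs_mul, abs_mul (F y * ‖y‖), abs_mul (F y), abs_norm]
    ring
  · have h1 : HasFDerivAt (fun z : EuclideanSpace ℝ (Fin d) => (inner ℝ z y : ℝ))
        (innerSL ℝ y) z := by
      have := (innerSL ℝ y).hasFDerivAt (x := z)
      refine this.congr_of_eventuallyEq (.of_forall fun w => ?_)
      simp [real_inner_comm]
    have h2 := (((h1.const_mul β).exp).mul_const (q y)).mul_const (F y)
    refine h2.congr_fderiv ?_
    ext w
    simp
    ring

theorem fderiv_tiltInt (hq : IsTiltBase β c q) (hF : ExpGrowth F)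
    (x v : EuclideanSpace ℝ (Fin d)) :
    fderiv ℝ (tiltInt β q F) x v = β * tiltInt β q (fun y => F y * inner ℝ v y) x := by
  rw [(hq.hasFDerivAt_tiltInt hF x).fderiv, ContinuousLinearMap.integral_apply]
  · rw [tiltInt, ← integral_const_mul]
    congr 1 with y
    simp [real_inner_comm]
    ring
  · refine ((hq.integrable_tilt ((hF.mul .norm).mul (.const β)) x).norm).mono' ?_
      (.of_forall fun y => ?_)
    · refine (hq.integrable_tilt hF x).1.smul ?_
      have : Continuous fun y : EuclideanSpace ℝ (Fin d) => β • innerSL ℝ y := by fun_prop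
      exact this.aestronglyMeasurable
    · rw [norm_smul, norm_smul, innerSL_apply_norm, norm_mul, norm_mul _ (F y * ‖y‖ * β),
        norm_mul (F y * ‖y‖), norm_mul (F y), norm_norm]
      exact le_of_eq (by ring)

theorem hasFDerivAt_tiltMean (hq : IsTiltBase β c q) (hF : ExpGrowth F)
    (x : EuclideanSpace ℝ (Fin d)) :
    HasFDerivAt (tiltMean β q F)
      (tiltInt β q F x • (-(tiltZ β q x ^ 2)⁻¹ • fderiv ℝ (tiltInt β q fun _ => 1) x) +
        (tiltZ β q x)⁻¹ • fderiv ℝ (tiltInt β q F) x) x := by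
  have h1 := (hq.hasFDerivAt_tiltInt hF x).differentiableAt.hasFDerivAt
  have h2 : HasFDerivAt (tiltZ β q) (fderiv ℝ (tiltInt β q fun _ => 1) x) x :=
    (hq.hasFDerivAt_tiltInt (.const 1) x).differentiableAt.hasFDerivAt
  exact h1.mul ((hasDerivAt_inv (hq.tiltZ_pos x).ne').comp_hasFDerivAt x h2)

theorem differentiable_tiltMean (hq : IsTiltBase β c q) (hF : ExpGrowth F) :
    Differentiable ℝ (tiltMean β q F) := fun x =>
  (hq.hasFDerivAt_tiltMean hF x).differentiableAt

/-- The right-hand side is β times the covariance of F and ⟪v, ·⟫ under the tilted measure; the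
second term comes from the derivative of 1/Z. -/
theorem fderiv_tiltMean (hq : IsTiltBase β c q) (hF : ExpGrowth F)
    (x v : EuclideanSpace ℝ (Fin d)) :
    fderiv ℝ (tiltMean β q F) x v = β * (tiltMean β q (fun y => F y * inner ℝ v y) x -
      tiltMean β q F x * tiltMean β q (fun y => inner ℝ v y) x) := by
  have hZ := (hq.tiltZ_pos x).ne'
  have e2 : fderiv ℝ (tiltInt β q fun _ => 1) x v = β * tiltInt β q (fun y => inner ℝ v y) x := by
    rw [hq.fderiv_tiltInt (.const 1)]
    simp_rw [one_mul]
  rw [(hq.hasFDerivAt_tiltMean hF x).fderiv]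
  simp only [add_apply, smul_apply, smul_eq_mul,
    hq.fderiv_tiltInt hF, e2, tiltMean]
  field_simp
  ring

theorem tiltMean_sub_const_mul (hq : IsTiltBase β c q) (hF : ExpGrowth F) (hG : ExpGrowth G)
    (a : ℝ) (x : EuclideanSpace ℝ (Fin d)) :
    tiltMean β q (fun y => (F y - a) * G y) x =
      tiltMean β q (fun y => F y * G y) x - a * tiltMean β q G x := by
  have e : tiltInt β q (fun y => (F y - a) * G y) x =
      tiltInt β q (fun y => F y * G y) x - a * tiltInt β q G x := by
    rw [tiltInt, tiltInt, tiltInt, ← integral_const_mul,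
      ← integral_sub (hq.integrable_tilt (hF.mul hG) x) ((hq.integrable_tilt hG x).const_mul a)]
    congr 1 with y
    ring
  rw [tiltMean, e, tiltMean, tiltMean]
  ring

theorem tiltMean_const (hq : IsTiltBase β c q) (a : ℝ) (x : EuclideanSpace ℝ (Fin d)) :
    tiltMean β q (fun _ => a) x = a := by
  have := hq.isProbabilityMeasure x
  rw [← hq.integral_tiltMeasure]
  simp

theorem tiltMean_covariance (hq : IsTiltBase β c q) (hF : ExpGrowth F) (hG : ExpGrowth G)
    (x : EuclideanSpace ℝ (Fin d)) :
    tiltMean β q (fun y => (F y - tiltMean β q F x) * (G y - tiltMean β q G x)) x =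
      tiltMean β q (fun y => F y * G y) x - tiltMean β q F x * tiltMean β q G x := by
  have h0 : tiltMean β q (fun y => G y - tiltMean β q G x) x = 0 := by
    have := hq.tiltMean_sub_const_mul hG (.const 1) (tiltMean β q G x) x
    simpa [hq.tiltMean_const] using this
  rw [hq.tiltMean_sub_const_mul hF (hG.sub_const _), h0]
  simp_rw [mul_comm (F _)]
  rw [hq.tiltMean_sub_const_mul hG hF]
  ring

/-- The expansion is grouped as the derivative of the covariance of F and G in the direction H, up
to the factor β. -/
theorem tiltMean_third_cumulant {H : EuclideanSpace ℝ (Fin d) → ℝ} (hq : IsTiltBase β c q)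
    (hF : ExpGrowth F) (hG : ExpGrowth G) (hH : ExpGrowth H) (x : EuclideanSpace ℝ (Fin d)) :
    tiltMean β q (fun y => (F y - tiltMean β q F x) *
        ((G y - tiltMean β q G x) * (H y - tiltMean β q H x))) x =
      tiltMean β q (fun y => F y * G y * H y) x
        - tiltMean β q (fun y => F y * G y) x * tiltMean β q H x
        - (tiltMean β q (fun y => F y * H y) x - tiltMean β q F x * tiltMean β q H x) *
          tiltMean β q G x
        - tiltMean β q F x * (tiltMean β q (fun y => G y * H y) x -
          tiltMean β q G x * tiltMean β q H x) := by
  have hG' := hG.sub_const (tiltMean β q G x)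
  have hH' := hH.sub_const (tiltMean β q H x)
  rw [hq.tiltMean_sub_const_mul hF (hG'.mul hH'), hq.tiltMean_covariance hG hH]
  have e1 : (fun y => F y * ((G y - tiltMean β q G x) * (H y - tiltMean β q H x))) =
      fun y => (G y - tiltMean β q G x) * (F y * (H y - tiltMean β q H x)) := by
    ext y
    ring
  rw [e1, hq.tiltMean_sub_const_mul hG (hF.mul hH')]
  have e2 : (fun y => G y * (F y * (H y - tiltMean β q H x))) =
      fun y => (H y - tiltMean β q H x) * (F y * G y) := by
    ext y
    ring
  have e3 : (fun y => F y * (H y - tiltMean β q H x)) =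
      fun y => (H y - tiltMean β q H x) * F y := by
    ext y
    ring
  rw [e2, e3, hq.tiltMean_sub_const_mul hH (hF.mul hG), hq.tiltMean_sub_const_mul hH hF]
  simp_rw [mul_comm (H _)]
  ring

theorem abs_covariance_le (hq : IsTiltBase β c q) (hL : 0 ≤ L) (hF : LipBound L F)
    (x v : EuclideanSpace ℝ (Fin d)) :
    |tiltMean β q (fun y => F y * inner ℝ v y) x -
      tiltMean β q F x * tiltMean β q (fun y => inner ℝ v y) x| ≤ L * ‖v‖ / c := by
  have := hq.isProbabilityMeasure x
  have h := (hq.lipschitzConcentration x).abs_covariance_le (hq.beta_pos.trans hq.beta_lt) hL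
    (norm_nonneg v) hF (lipBound_inner_left v)
  simp_rw [hq.integral_tiltMeasure] at h
  rwa [hq.tiltMean_covariance (.of_lipBound hF) (.inner_left v)] at h

/-- The contraction estimate: the gradient of the mean is β times a covariance, and that is at most
L‖v‖/c. -/
theorem lipBound_tiltMean (hq : IsTiltBase β c q) (hL : 0 ≤ L) (hF : LipBound L F) :
    LipBound (β / c * L) (tiltMean β q F) := by
  intro x y
  have hc := hq.beta_pos.trans hq.beta_lt
  have hβ := hq.beta_pos
  refine Convex.norm_image_sub_le_of_norm_fderiv_le (𝕜 := ℝ) (s := Set.univ)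
    (fun z _ => hq.differentiable_tiltMean (.of_lipBound hF) z) (fun z _ => ?_) convex_univ
    (Set.mem_univ _) (Set.mem_univ _)
  refine ContinuousLinearMap.opNorm_le_bound _ (by positivity) fun v => ?_
  rw [hq.fderiv_tiltMean (.of_lipBound hF), norm_mul, Real.norm_eq_abs, Real.norm_eq_abs,
    abs_of_pos hβ]
  calc _ ≤ β * (L * ‖v‖ / c) :=
        mul_le_mul_of_nonneg_left (hq.abs_covariance_le hL hF z v) hβ.le
    _ = _ := by ring

end IsTiltBase

/-! ### The stationary weight and uniqueness -/

namespace IsTiltBase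

variable {d : ℕ} {β c L : ℝ} {q F G f h : EuclideanSpace ℝ (Fin d) → ℝ}
  {x v : EuclideanSpace ℝ (Fin d)}

theorem continuous_tiltZ (hq : IsTiltBase β c q) : Continuous (tiltZ β q) :=
  continuous_iff_continuousAt.2 fun x => (hq.hasFDerivAt_tiltInt (.const 1) x).continuousAt

theorem weight_pos (hq : IsTiltBase β c q) (x : EuclideanSpace ℝ (Fin d)) :
    0 < q x * tiltZ β q x :=
  mul_pos (hq.pos x) (hq.tiltZ_pos x)

theorem measurable_weight (hq : IsTiltBase β c q) : Measurable fun x => q x * tiltZ β q x :=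
  hq.measurable.mul hq.continuous_tiltZ.measurable

/-- Splitting β⟪x,y⟫ ≤ β(|x|² + |y|²)/2 shows Z(x) ≤ I·exp(β|x|²/2), which the Gaussian bound on q
beats by a factor exp(-δ|x|²). -/
theorem integrable_mul_weight (hq : IsTiltBase β c q) (hF : ExpGrowth F) :
    Integrable fun x => F x * (q x * tiltZ β q x) := by
  obtain ⟨C, δ, hδ, hC⟩ := hq.bound
  have hβ := hq.beta_pos
  obtain ⟨hFm, A, b, hA, hb, hFb⟩ := hF
  have hC0 : 0 < C := by
    have := (hq.pos 0).trans_le (hC 0)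
    simpa using this
  set I := ∫ y : EuclideanSpace ℝ (Fin d), C * Real.exp (0 * ‖y‖ - δ * ‖y‖ ^ 2)
  have hI : 0 ≤ I := integral_nonneg fun y => by positivity
  have hZ : ∀ x, tiltZ β q x ≤ I * Real.exp (β / 2 * ‖x‖ ^ 2) := fun x => by
    rw [tiltZ, tiltInt, ← integral_mul_const]
    refine integral_mono (hq.integrable_tilt (.const 1) x)
      (((integrable_exp_mul_norm_sub_sq 0 hδ).const_mul C).mul_const _) fun y => ?_
    have hin : β * inner ℝ x y ≤ β / 2 * ‖x‖ ^ 2 + β / 2 * ‖y‖ ^ 2 := by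
      have := real_inner_le_norm x y
      nlinarith [sq_nonneg (‖x‖ - ‖y‖)]
    calc Real.exp (β * inner ℝ x y) * q y * 1
        ≤ Real.exp (β / 2 * ‖x‖ ^ 2 + β / 2 * ‖y‖ ^ 2) *
          (C * Real.exp (-(β / 2 + δ) * ‖y‖ ^ 2)) := by
          rw [mul_one]
          exact mul_le_mul (Real.exp_le_exp.2 hin) (hC y) (hq.pos y).le (Real.exp_pos _).le
      _ = C * (Real.exp (β / 2 * ‖x‖ ^ 2 + β / 2 * ‖y‖ ^ 2) *
          Real.exp (-(β / 2 + δ) * ‖y‖ ^ 2)) := by ring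
      _ = C * (Real.exp (0 * ‖y‖ - δ * ‖y‖ ^ 2) * Real.exp (β / 2 * ‖x‖ ^ 2)) := by
          rw [← Real.exp_add, ← Real.exp_add]
          ring_nf
      _ = _ := by ring
  refine ((integrable_exp_mul_norm_sub_sq b hδ).const_mul (A * C * I)).mono'
    (hFm.mul hq.measurable_weight).aestronglyMeasurable (.of_forall fun x => ?_)
  rw [norm_mul, Real.norm_eq_abs, Real.norm_eq_abs, abs_of_pos (hq.weight_pos x)]
  calc |F x| * (q x * tiltZ β q x)
      ≤ A * Real.exp (b * ‖x‖) * (C * Real.exp (-(β / 2 + δ) * ‖x‖ ^ 2) *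
        (I * Real.exp (β / 2 * ‖x‖ ^ 2))) := by
        refine mul_le_mul (hFb x) ?_ (hq.weight_pos x).le (by positivity)
        exact mul_le_mul (hC x) (hZ x) (hq.tiltZ_pos x).le (by positivity)
    _ = A * C * I * (Real.exp (b * ‖x‖) * Real.exp (-(β / 2 + δ) * ‖x‖ ^ 2) *
        Real.exp (β / 2 * ‖x‖ ^ 2)) := by ring
    _ = _ := by
        rw [← Real.exp_add, ← Real.exp_add]
        ring_nf

theorem integrable_weight (hq : IsTiltBase β c q) : Integrable fun x => q x * tiltZ β q x := by
  simpa using hq.integrable_mul_weight (.const 1)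

theorem integral_weight_pos (hq : IsTiltBase β c q) : 0 < ∫ x, q x * tiltZ β q x := by
  rw [integral_pos_iff_support_of_nonneg (fun x => (hq.weight_pos x).le) hq.integrable_weight]
  have : (Function.support fun x => q x * tiltZ β q x) = Set.univ :=
    Set.eq_univ_of_forall fun y => (hq.weight_pos y).ne'
  rw [this]
  exact isOpen_univ.measure_pos volume Set.univ_nonempty

theorem aestronglyMeasurable_of_mul_weight (hq : IsTiltBase β c q)
    (hf : AEStronglyMeasurable (fun x => f x * (q x * tiltZ β q x)) volume) :
    AEStronglyMeasurable f volume := by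
  refine (hf.mul hq.measurable_weight.inv.aestronglyMeasurable).congr (.of_forall fun x => ?_)
  have := (hq.weight_pos x).ne'
  simp only [Pi.mul_apply, Pi.inv_apply]
  rw [mul_assoc, mul_inv_cancel₀ this, mul_one]

/-- The kernel q(x) exp(β⟪x,y⟫) q(y) is symmetric with marginal qZ, so integrating over x first
leaves |f|qZ. This justifies the Fubini exchange behind stationarity. -/
theorem integrable_joint (hq : IsTiltBase β c q)
    (hf : Integrable fun x => f x * (q x * tiltZ β q x)) :
    Integrable (Function.uncurry fun x y : EuclideanSpace ℝ (Fin d) =>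
      q x * (Real.exp (β * inner ℝ x y) * q y * f y)) (volume.prod volume) := by
  have hqm := hq.measurable
  have hfm := hq.aestronglyMeasurable_of_mul_weight hf.1
  rw [integrable_prod_iff']
  · have hsec : ∀ y : EuclideanSpace ℝ (Fin d), Integrable fun x =>
        q x * (Real.exp (β * inner ℝ x y) * q y * f y) := fun y => by
      refine ((hq.integrable_tilt (.const 1) y).mul_const (q y * f y)).congr
        (.of_forall fun x => ?_)
      simp only [real_inner_comm x y]
      ring
    refine ⟨.of_forall hsec, hf.norm.congr (.of_forall fun y => ?_)⟩
    simp only [Function.uncurry]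
    have e : ∀ x, ‖q x * (Real.exp (β * inner ℝ x y) * q y * f y)‖ =
        Real.exp (β * inner ℝ y x) * q x * 1 * (q y * ‖f y‖) := fun x => by
      rw [norm_mul, norm_mul, norm_mul, Real.norm_of_nonneg (hq.pos x).le,
        Real.norm_of_nonneg (hq.pos y).le, Real.norm_of_nonneg (Real.exp_pos _).le,
        real_inner_comm x y]
      ring
    simp_rw [e]
    rw [integral_mul_const, norm_mul, Real.norm_of_nonneg (hq.weight_pos y).le]
    change _ = tiltZ β q y * _
    ring
  · have h1 : Measurable fun z : EuclideanSpace ℝ (Fin d) × EuclideanSpace ℝ (Fin d) =>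
        q z.1 * (Real.exp (β * inner ℝ z.1 z.2) * q z.2) := by fun_prop
    refine (h1.aestronglyMeasurable.mul (hfm.comp_snd (μ := volume))).congr
      (.of_forall fun z => ?_)
    simp only [Pi.mul_apply, Function.uncurry]
    ring

theorem tiltMean_mul_weight (hq : IsTiltBase β c q) (f : EuclideanSpace ℝ (Fin d) → ℝ)
    (x : EuclideanSpace ℝ (Fin d)) :
    tiltMean β q f x * (q x * tiltZ β q x) =
      ∫ y, q x * (Real.exp (β * inner ℝ x y) * q y * f y) := by
  rw [integral_const_mul, tiltMean]
  have := (hq.tiltZ_pos x).ne'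
  change _ = q x * tiltInt β q f x
  field_simp

theorem integrable_tiltMean_mul_weight (hq : IsTiltBase β c q)
    (hf : Integrable fun x => f x * (q x * tiltZ β q x)) :
    Integrable fun x => tiltMean β q f x * (q x * tiltZ β q x) := by
  simp_rw [hq.tiltMean_mul_weight]
  exact (hq.integrable_joint hf).integral_prod_left

/-- The weight `q Z` is stationary for the Markov operator `tiltMean`. -/
theorem integral_tiltMean_mul_weight (hq : IsTiltBase β c q)
    (hf : Integrable fun x => f x * (q x * tiltZ β q x)) :
    ∫ x, tiltMean β q f x * (q x * tiltZ β q x) = ∫ x, f x * (q x * tiltZ β q x) := by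
  simp_rw [hq.tiltMean_mul_weight]
  rw [integral_integral_swap (hq.integrable_joint hf)]
  congr 1 with y
  have e : ∀ x, q x * (Real.exp (β * inner ℝ x y) * q y * f y) =
      Real.exp (β * inner ℝ y x) * q x * 1 * (q y * f y) := fun x => by
    rw [real_inner_comm x y]
    ring
  simp_rw [e]
  rw [integral_mul_const]
  change tiltZ β q y * _ = _
  ring

/-- A harmonic function that is integrable with mean zero for the stationary weight vanishes. -/
theorem eq_zero_of_tiltMean_eq (hq : IsTiltBase β c q)
    (hf : Integrable fun x => f x * (q x * tiltZ β q x))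
    (hop : ∀ x, Integrable fun y => Real.exp (β * inner ℝ x y) * q y * f y)
    (hfix : ∀ x, f x = tiltMean β q f x) (h0 : ∫ x, f x * (q x * tiltZ β q x) = 0) :
    f = 0 := by
  have habs : Integrable fun x => |f x| * (q x * tiltZ β q x) :=
    hf.norm.congr (.of_forall fun x => by
      dsimp only
      rw [norm_mul, Real.norm_of_nonneg (hq.weight_pos x).le, Real.norm_eq_abs])
  have hle : ∀ x, |f x| ≤ tiltMean β q (fun y => |f y|) x := fun x => by
    rw [hfix x, tiltMean, tiltMean, abs_div, abs_of_pos (hq.tiltZ_pos x)]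
    refine div_le_div_of_nonneg_right ?_ (hq.tiltZ_pos x).le
    refine abs_integral_le_integral_abs.trans (le_of_eq ?_)
    rw [tiltInt]
    congr 1 with y
    rw [abs_mul, abs_of_pos (mul_pos (Real.exp_pos _) (hq.pos y))]
  -- Stationarity upgrades |f| ≤ T|f| to equality almost everywhere; one point of equality is enough
  -- below.
  have hint : ∫ x, (tiltMean β q (fun y => |f y|) x * (q x * tiltZ β q x) -
      |f x| * (q x * tiltZ β q x)) = 0 := by
    rw [integral_sub (hq.integrable_tiltMean_mul_weight habs) habs,
      hq.integral_tiltMean_mul_weight habs, sub_self]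
  rw [integral_eq_zero_iff_of_nonneg
    (fun x => sub_nonneg.2 (mul_le_mul_of_nonneg_right (hle x) (hq.weight_pos x).le))
    ((hq.integrable_tiltMean_mul_weight habs).sub habs)] at hint
  obtain ⟨x, hx⟩ := hint.exists
  have hx' : tiltMean β q (fun y => |f y|) x = |tiltMean β q f x| := by
    simp only [Pi.zero_apply, ← sub_mul] at hx
    rcases mul_eq_zero.1 hx with hx | hx
    · rw [← hfix x]
      linarith
    · exact absurd hx (hq.weight_pos x).ne'
  have hZ := hq.tiltZ_pos x
  have hw : ∀ y, 0 < Real.exp (β * inner ℝ x y) * q y := fun y =>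
    mul_pos (Real.exp_pos _) (hq.pos y)
  have habs' : Integrable fun y => Real.exp (β * inner ℝ x y) * q y * |f y| :=
    (hop x).norm.congr (.of_forall fun y => by
      dsimp only
      rw [norm_mul, Real.norm_of_nonneg (hw y).le, Real.norm_eq_abs])
  have hx2 : tiltInt β q (fun y => |f y|) x = |tiltInt β q f x| := by
    rw [tiltMean, tiltMean, abs_div, abs_of_pos hZ, div_left_inj' hZ.ne'] at hx'
    exact hx'
  -- Equality in the triangle inequality against a strictly positive weight forces f to have
  -- constant sign almost everywhere; stationary mean zero then makes it vanish almost everywhere.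
  have hae : f =ᵐ[volume] 0 := by
    have concl : ∀ g : EuclideanSpace ℝ (Fin d) → ℝ,
        Integrable (fun x => g x * (q x * tiltZ β q x)) →
        ∫ x, g x * (q x * tiltZ β q x) = 0 → 0 ≤ᵐ[volume] g → g =ᵐ[volume] 0 := by
      intro g hg hg0 hpos
      rw [integral_eq_zero_iff_of_nonneg_ae
        (hpos.mono fun y hy => mul_nonneg hy (hq.weight_pos y).le) hg] at hg0
      exact hg0.mono fun y hy => (mul_eq_zero.1 hy).resolve_right (hq.weight_pos y).ne'
    rcases le_total 0 (tiltInt β q f x) with hs | hs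
    · rw [abs_of_nonneg hs] at hx2
      have h1 : ∫ y, (Real.exp (β * inner ℝ x y) * q y * |f y| -
          Real.exp (β * inner ℝ x y) * q y * f y) = 0 := by
        rw [integral_sub habs' (hop x), sub_eq_zero]
        exact hx2
      rw [integral_eq_zero_iff_of_nonneg (fun y => sub_nonneg.2
        (mul_le_mul_of_nonneg_left (le_abs_self _) (hw y).le)) (habs'.sub (hop x))] at h1
      refine concl f hf h0 (h1.mono fun y hy => ?_)
      simp only [Pi.zero_apply, ← mul_sub] at hy
      have := (mul_eq_zero.1 hy).resolve_left (hw y).ne'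
      have := abs_nonneg (f y)
      simp only [Pi.zero_apply]
      linarith
    · rw [abs_of_nonpos hs] at hx2
      have h1 : ∫ y, (Real.exp (β * inner ℝ x y) * q y * |f y| +
          Real.exp (β * inner ℝ x y) * q y * f y) = 0 := by
        rw [integral_add habs' (hop x)]
        have : tiltInt β q (fun y => |f y|) x + tiltInt β q f x = 0 := by linarith
        exact this
      rw [integral_eq_zero_iff_of_nonneg (fun y => by
        change 0 ≤ Real.exp (β * inner ℝ x y) * q y * |f y| +
          Real.exp (β * inner ℝ x y) * q y * f y
        rw [← mul_add]
        exact mul_nonneg (hw y).le (by linarith [neg_abs_le (f y)]))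
        (by exact habs'.add (hop x))] at h1
      have hneg : (fun y => -f y) =ᵐ[volume] 0 := by
        refine concl _ (by simp only [neg_mul]; exact hf.neg) ?_ (h1.mono fun y hy => ?_)
        · simp only [neg_mul]
          rw [integral_neg, h0, neg_zero]
        · simp only [Pi.zero_apply, ← mul_add] at hy
          have := (mul_eq_zero.1 hy).resolve_left (hw y).ne'
          have := abs_nonneg (f y)
          simp only [Pi.zero_apply]
          linarith
      exact hneg.mono fun y hy => neg_eq_zero.1 hy
  -- The integral Tf ignores null sets, so f = Tf extends the vanishing to every point.
  ext z
  rw [hfix z, tiltMean, tiltInt, integral_congr_ae (g := fun _ => (0 : ℝ))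
    (hae.mono fun y hy => by simp [hy])]
  simp

/-- Bound for a Lipschitz function of mean zero for the stationary weight. -/
theorem abs_le_of_integral_weight_eq_zero (hq : IsTiltBase β c q) (hL : 0 ≤ L)
    (hF : LipBound L F) (h0 : ∫ x, F x * (q x * tiltZ β q x) = 0) (x : EuclideanSpace ℝ (Fin d)) :
    |F x| ≤ L * (‖x‖ + (∫ y, ‖y‖ * (q y * tiltZ β q y)) / ∫ y, q y * tiltZ β q y) := by
  have hN := hq.integral_weight_pos
  set N := ∫ y, q y * tiltZ β q y
  have hI := hq.integrable_mul_weight (.of_lipBound hF)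
  have hI1 := hq.integrable_mul_weight (d := d) .norm
  -- Mean zero allows F(y) to be subtracted, and the Lipschitz bound applies to the difference.
  have e : F x * N = ∫ y, (F x - F y) * (q y * tiltZ β q y) := by
    simp_rw [sub_mul]
    rw [integral_sub (hq.integrable_weight.const_mul _) hI, h0, integral_const_mul, sub_zero]
  have h1 : |F x| * N ≤ L * (‖x‖ * N + ∫ y, ‖y‖ * (q y * tiltZ β q y)) := by
    rw [← abs_of_pos hN, ← abs_mul, e]
    have e2 : L * (‖x‖ * |N| + ∫ y, ‖y‖ * (q y * tiltZ β q y)) =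
        ∫ y, L * (‖x‖ * (q y * tiltZ β q y) + ‖y‖ * (q y * tiltZ β q y)) := by
      rw [abs_of_pos hN, integral_const_mul,
        integral_add (hq.integrable_weight.const_mul _) hI1, integral_const_mul]
    rw [e2]
    refine abs_integral_le_integral_abs.trans ?_
    refine integral_mono ?_ (((hq.integrable_weight.const_mul _).add hI1).const_mul L)
      fun y => ?_
    · simp_rw [sub_mul]
      exact ((hq.integrable_weight.const_mul _).sub hI).abs
    · change |(F x - F y) * (q y * tiltZ β q y)| ≤
        L * (‖x‖ * (q y * tiltZ β q y) + ‖y‖ * (q y * tiltZ β q y))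
      rw [abs_mul, abs_of_pos (hq.weight_pos y), ← add_mul, ← mul_assoc L]
      refine mul_le_mul_of_nonneg_right ?_ (hq.weight_pos y).le
      exact (hF x y).trans (mul_le_mul_of_nonneg_left (norm_sub_le _ _) hL)
  calc |F x| = |F x| * N / N := by field_simp
    _ ≤ L * (‖x‖ * N + ∫ y, ‖y‖ * (q y * tiltZ β q y)) / N := by gcongr
    _ = _ := by field_simp

end IsTiltBase

/-! ### The Poisson equation by Neumann series -/

namespace IsTiltBase

variable {d : ℕ} {β c L : ℝ} {q F G f h : EuclideanSpace ℝ (Fin d) → ℝ}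
  {x v : EuclideanSpace ℝ (Fin d)}

theorem div_lt_one (hq : IsTiltBase β c q) : β / c < 1 :=
  (_root_.div_lt_one (hq.beta_pos.trans hq.beta_lt)).2 hq.beta_lt

theorem div_pos (hq : IsTiltBase β c q) : 0 < β / c :=
  _root_.div_pos hq.beta_pos (hq.beta_pos.trans hq.beta_lt)

theorem lipBound_iterate (hq : IsTiltBase β c q) (hL : 0 ≤ L) (hF : LipBound L F) (n : ℕ) :
    LipBound ((β / c) ^ n * L) ((tiltMean β q)^[n] F) := by
  induction n with
  | zero => simpa using hF
  | succ n ih =>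
    rw [Function.iterate_succ_apply', pow_succ', mul_assoc]
    exact hq.lipBound_tiltMean (mul_nonneg (pow_nonneg hq.div_pos.le n) hL) ih

theorem integral_iterate_mul_weight (hq : IsTiltBase β c q) (hL : 0 ≤ L) (hF : LipBound L F)
    (n : ℕ) : ∫ x, (tiltMean β q)^[n] F x * (q x * tiltZ β q x) =
      ∫ x, F x * (q x * tiltZ β q x) := by
  induction n with
  | zero => simp
  | succ n ih =>
    rw [Function.iterate_succ_apply', hq.integral_tiltMean_mul_weight
      (hq.integrable_mul_weight (.of_lipBound (hq.lipBound_iterate hL hF n))), ih]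

/-- Poisson equation for the Markov operator, with a Lipschitz right-hand side of mean zero:
the solution is the Neumann series. -/
theorem exists_lipBound_solution (hq : IsTiltBase β c q) (hL : 0 ≤ L) (hF : LipBound L F)
    (h0 : ∫ x, F x * (q x * tiltZ β q x) = 0) :
    ∃ u : EuclideanSpace ℝ (Fin d) → ℝ, LipBound (L / (1 - β / c)) u ∧
      ∀ x, u x = tiltMean β q u x + F x := by
  set θ := β / c
  have hθ0 : 0 ≤ θ := hq.div_pos.le
  have hθ1 : θ < 1 := hq.div_lt_one
  set f : ℕ → EuclideanSpace ℝ (Fin d) → ℝ := fun n => (tiltMean β q)^[n] F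
  set m := (∫ y, ‖y‖ * (q y * tiltZ β q y)) / ∫ y, q y * tiltZ β q y
  have hf : ∀ n, LipBound (θ ^ n * L) (f n) := hq.lipBound_iterate hL hF
  have hgeo : HasSum (fun n => θ ^ n * L) (L / (1 - θ)) := by
    simpa [div_eq_inv_mul] using (hasSum_geometric_of_lt_one hθ0 hθ1).mul_right L
  -- Small Lipschitz constants alone do not make the series converge. The iterates keep stationary
  -- mean zero, and this turns them into a pointwise geometric bound.
  have hb : ∀ n x, |f n x| ≤ θ ^ n * L * (‖x‖ + m) := fun n x =>
    hq.abs_le_of_integral_weight_eq_zero (mul_nonneg (pow_nonneg hθ0 n) hL) (hf n)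
      ((hq.integral_iterate_mul_weight hL hF n).trans h0) x
  have hsum : ∀ x, Summable fun n => f n x := fun x =>
    .of_norm_bounded (hgeo.summable.mul_right (‖x‖ + m)) fun n => hb n x
  refine ⟨fun x => ∑' n, f n x, fun x y => ?_, fun x => ?_⟩
  · rw [← (hsum x).tsum_sub (hsum y), ← Real.norm_eq_abs]
    exact tsum_of_norm_bounded (hgeo.mul_right ‖x - y‖) fun n => hf n x y
  · have := hq.isProbabilityMeasure x
    have hI : ∀ n, Integrable (f n) (tiltMeasure β q x) := fun n =>
      (hq.lipschitzConcentration x).integrable (hf n)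
    have hnorm : Integrable (fun y : EuclideanSpace ℝ (Fin d) => ‖y‖) (tiltMeasure β q x) :=
      hq.integrable_tiltMeasure_iff.2 (hq.integrable_tilt .norm x)
    have hS : Summable fun n => ∫ y, ‖f n y‖ ∂(tiltMeasure β q x) := by
      refine .of_nonneg_of_le (fun n => integral_nonneg fun y => norm_nonneg _) (fun n => ?_)
        (hgeo.summable.mul_right (∫ y, (‖y‖ + m) ∂(tiltMeasure β q x)))
      rw [← integral_const_mul]
      exact integral_mono (hI n).norm ((hnorm.add (integrable_const m)).const_mul _)
        fun y => hb n y
    have hT := hasSum_integral_of_summable_integral_norm hI hS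
    simp_rw [hq.integral_tiltMeasure] at hT
    dsimp only
    rw [← hT.tsum_eq, (hsum x).tsum_eq_zero_add, add_comm]
    congr 1
    exact tsum_congr fun n => by
      simp only [f, Function.iterate_succ_apply']

end IsTiltBase

/-! ### Strong convexity from the Hessian bound, along lines -/

section StrongConvexity

variable {E : Type*} [NormedAddCommGroup E] [NormedSpace ℝ E] {V : E → ℝ} {c : ℝ}

theorem hasDerivAt_line_sub_sq (hV : Differentiable ℝ V) (x w : E) (t : ℝ) :
    HasDerivAt (fun t : ℝ => V (x + t • w) - c / 2 * ‖w‖ ^ 2 * t ^ 2)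
      (fderiv ℝ V (x + t • w) w - c * ‖w‖ ^ 2 * t) t := by
  have hl : HasDerivAt (fun t : ℝ => x + t • w) w t := by
    simpa using ((hasDerivAt_id t).smul_const w).const_add x
  have h1 := (hV (x + t • w)).hasFDerivAt.comp_hasDerivAt t hl
  have h2 := ((hasDerivAt_pow 2 t).const_mul (c / 2 * ‖w‖ ^ 2))
  refine (h1.sub h2).congr_deriv ?_
  simp
  ring

theorem convexOn_line_sub_sq (hV : Differentiable ℝ V) (hV' : Differentiable ℝ (fderiv ℝ V))
    (h : ∀ x v, c * ‖v‖ ^ 2 ≤ fderiv ℝ (fderiv ℝ V) x v v) (x w : E) :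
    ConvexOn ℝ Set.univ fun t : ℝ => V (x + t • w) - c / 2 * ‖w‖ ^ 2 * t ^ 2 := by
  have hd := hasDerivAt_line_sub_sq (c := c) hV x w
  refine Monotone.convexOn_univ_of_deriv (fun t => (hd t).differentiableAt) ?_
  rw [funext fun t => (hd t).deriv]
  have hd' : ∀ t : ℝ, HasDerivAt (fun t : ℝ => fderiv ℝ V (x + t • w) w - c * ‖w‖ ^ 2 * t)
      (fderiv ℝ (fderiv ℝ V) (x + t • w) w w - c * ‖w‖ ^ 2) t := fun t => by
    have hl : HasDerivAt (fun t : ℝ => x + t • w) w t := by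
      simpa using ((hasDerivAt_id t).smul_const w).const_add x
    have h1 : HasDerivAt (fun t : ℝ => fderiv ℝ V (x + t • w))
        (fderiv ℝ (fderiv ℝ V) (x + t • w) w) t :=
      (hV' (x + t • w)).hasFDerivAt.comp_hasDerivAt t hl
    have h2 : HasDerivAt (fun t : ℝ => fderiv ℝ V (x + t • w) w)
        (fderiv ℝ (fderiv ℝ V) (x + t • w) w w) t := by
      simpa using h1.clm_apply (hasDerivAt_const t w)
    have h3 : HasDerivAt (fun t : ℝ => c * ‖w‖ ^ 2 * t) (c * ‖w‖ ^ 2) t := by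
      simpa using (hasDerivAt_id t).const_mul (c * ‖w‖ ^ 2)
    exact h2.sub h3
  refine monotone_of_deriv_nonneg (fun t => (hd' t).differentiableAt) fun t => ?_
  rw [(hd' t).deriv]
  exact sub_nonneg.2 (h _ _)

theorem midpoint_le_of_hessian (hV : Differentiable ℝ V) (hV' : Differentiable ℝ (fderiv ℝ V))
    (h : ∀ x v, c * ‖v‖ ^ 2 ≤ fderiv ℝ (fderiv ℝ V) x v v) (x y : E) :
    2 * V ((1 / 2 : ℝ) • (x + y)) + c / 4 * ‖x - y‖ ^ 2 ≤ V x + V y := by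
  have key := (convexOn_line_sub_sq hV hV' h x (y - x)).2 (Set.mem_univ 0) (Set.mem_univ 1)
    (by norm_num : (0 : ℝ) ≤ 1 / 2) (by norm_num : (0 : ℝ) ≤ 1 / 2) (by norm_num)
  have e : x + ((1 / 2 : ℝ) • (0 : ℝ) + (1 / 2 : ℝ) • (1 : ℝ)) • (y - x) =
      (1 / 2 : ℝ) • (x + y) := by
    simp only [smul_eq_mul, mul_zero, zero_add, mul_one, smul_sub, smul_add]
    rw [← sub_eq_zero]
    module
  simp only [e] at key
  rw [norm_sub_rev x y]
  generalize (1 / 2 : ℝ) • (x + y) = m at *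
  simp at key
  linarith

theorem tangent_le_of_hessian (hV : Differentiable ℝ V) (hV' : Differentiable ℝ (fderiv ℝ V))
    (h : ∀ x v, c * ‖v‖ ^ 2 ≤ fderiv ℝ (fderiv ℝ V) x v v) (x : E) :
    V 0 + fderiv ℝ V 0 x + c / 2 * ‖x‖ ^ 2 ≤ V x := by
  have key := (convexOn_line_sub_sq hV hV' h 0 x).le_slope_of_hasDerivAt (Set.mem_univ 0)
    (Set.mem_univ 1) zero_lt_one (hasDerivAt_line_sub_sq (c := c) hV 0 x 0)
  simp [slope_def_field] at key
  linarith

end StrongConvexity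

/-! ### Strong log-concavity of the base density -/

/-- `∫ exp (β ⟪x, z⟫ - β ‖z‖² / 2 - V z) dz`. -/
noncomputable def gaussLaplace {d : ℕ} (β : ℝ) (V : EuclideanSpace ℝ (Fin d) → ℝ)
    (x : EuclideanSpace ℝ (Fin d)) : ℝ :=
  ∫ z, Real.exp (β * inner ℝ x z - β / 2 * ‖z‖ ^ 2 - V z)

section GaussLaplace

variable {d : ℕ} {β c : ℝ} {V : EuclideanSpace ℝ (Fin d) → ℝ}

theorem integrable_gaussLaplace (hβ : 0 < β) (hV : Continuous V)
    (hI : Integrable fun z => Real.exp (-V z)) (x : EuclideanSpace ℝ (Fin d)) :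
    Integrable fun z => Real.exp (β * inner ℝ x z - β / 2 * ‖z‖ ^ 2 - V z) := by
  refine (hI.const_mul (Real.exp (β / 2 * ‖x‖ ^ 2))).mono'
    (Continuous.aestronglyMeasurable (by fun_prop)) (.of_forall fun z => ?_)
  rw [Real.norm_of_nonneg (Real.exp_pos _).le, ← Real.exp_add]
  refine Real.exp_le_exp.2 ?_
  have := real_inner_le_norm x z
  nlinarith [sq_nonneg (‖x‖ - ‖z‖)]

theorem gaussLaplace_pos (hβ : 0 < β) (hV : Continuous V)
    (hI : Integrable fun z => Real.exp (-V z)) (x : EuclideanSpace ℝ (Fin d)) :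
    0 < gaussLaplace β V x :=
  integral_exp_pos (integrable_gaussLaplace hβ hV hI x)

theorem measurable_gaussLaplace (hV : Continuous V) : Measurable (gaussLaplace β V) := by
  have h : StronglyMeasurable (Function.uncurry fun x z : EuclideanSpace ℝ (Fin d) =>
      Real.exp (β * inner ℝ x z - β / 2 * ‖z‖ ^ 2 - V z)) :=
    Continuous.stronglyMeasurable (by unfold Function.uncurry; fun_prop)
  exact h.integral_prod_right.measurable

/-- Log-convexity of a Laplace transform in midpoint form: Cauchy–Schwarz for the square roots of
the integrands. -/
theorem gaussLaplace_midpoint_le (hβ : 0 < β) (hV : Continuous V)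
    (hI : Integrable fun z => Real.exp (-V z)) (x y : EuclideanSpace ℝ (Fin d)) :
    gaussLaplace β V ((1 / 2 : ℝ) • (x + y)) ^ 2 ≤ gaussLaplace β V x * gaussLaplace β V y := by
  have sq_exp : ∀ t : ℝ, Real.exp (t / 2) ^ 2 = Real.exp t := fun t => by
    rw [← Real.exp_nat_mul]
    congr 1
    push_cast
    ring
  have hprod : ∀ z : EuclideanSpace ℝ (Fin d),
      Real.exp ((β * inner ℝ x z - β / 2 * ‖z‖ ^ 2 - V z) / 2) *
        Real.exp ((β * inner ℝ y z - β / 2 * ‖z‖ ^ 2 - V z) / 2) =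
      Real.exp (β * inner ℝ ((1 / 2 : ℝ) • (x + y)) z - β / 2 * ‖z‖ ^ 2 - V z) := fun z => by
    rw [← Real.exp_add, real_inner_smul_left, inner_add_left]
    congr 1
    ring
  have key := integral_mul_sq_le (μ := volume)
    (a := fun z => Real.exp ((β * inner ℝ x z - β / 2 * ‖z‖ ^ 2 - V z) / 2))
    (b := fun z => Real.exp ((β * inner ℝ y z - β / 2 * ‖z‖ ^ 2 - V z) / 2))
    (by simpa only [sq_exp] using integrable_gaussLaplace hβ hV hI x)
    (by simpa only [sq_exp] using integrable_gaussLaplace hβ hV hI y)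
    (by simpa only [hprod] using integrable_gaussLaplace hβ hV hI _)
  simp only [sq_exp, hprod] at key
  exact key

/-- On the unit ball ⟪x,z⟫ ≥ -‖x‖. The resulting loss is only linear in the exponent, hence harmless
against Gaussian decay. -/
theorem exists_gaussLaplace_ge (hβ : 0 < β) (hV : Continuous V)
    (hI : Integrable fun z => Real.exp (-V z)) :
    ∃ a : ℝ, 0 < a ∧ ∀ x, a * Real.exp (-β * ‖x‖) ≤ gaussLaplace β V x := by
  set w : EuclideanSpace ℝ (Fin d) → ℝ := fun z => Real.exp (-(β / 2 * ‖z‖ ^ 2) - V z)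
  have hw : Integrable w :=
    (integrable_gaussLaplace hβ hV hI 0).congr (.of_forall fun z => by simp [w])
  refine ⟨∫ z in Metric.ball 0 1, w z, ?_, fun x => ?_⟩
  · rw [setIntegral_pos_iff_support_of_nonneg_ae (.of_forall fun z => (Real.exp_pos _).le)
      hw.integrableOn]
    have : Function.support w = Set.univ := Set.eq_univ_of_forall fun z => (Real.exp_pos _).ne'
    rw [this, Set.univ_inter]
    exact Metric.measure_ball_pos volume 0 one_pos
  · refine le_trans ?_ (setIntegral_le_integral (s := Metric.ball 0 1)
      (integrable_gaussLaplace hβ hV hI x) (.of_forall fun z => (Real.exp_pos _).le))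
    rw [← integral_mul_const]
    refine setIntegral_mono_on (hw.mul_const _).integrableOn
      (integrable_gaussLaplace hβ hV hI x).integrableOn measurableSet_ball fun z hz => ?_
    rw [← Real.exp_add]
    refine Real.exp_le_exp.2 ?_
    have h1 : -(‖x‖ * ‖z‖) ≤ inner ℝ x z := (abs_le.1 (abs_real_inner_le_norm x z)).1
    have h2 : ‖x‖ * ‖z‖ ≤ ‖x‖ := by
      rw [mem_ball_zero_iff] at hz
      exact mul_le_of_le_one_right (norm_nonneg x) hz.le
    nlinarith

/-- The base density `exp (-β ‖x‖² / 4 - V x) / √(gaussLaplace x)` of a Gaussian kernel that is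
normalized by the square root of its density estimate. -/
noncomputable def tiltBase (β : ℝ) (V : EuclideanSpace ℝ (Fin d) → ℝ)
    (x : EuclideanSpace ℝ (Fin d)) : ℝ :=
  Real.exp (-(β / 4 * ‖x‖ ^ 2) - V x) / √(gaussLaplace β V x)

theorem isTiltBase_tiltBase (hβ : 0 < β) (hc : β / 2 < c) (hV : Differentiable ℝ V)
    (hV' : Differentiable ℝ (fderiv ℝ V))
    (h : ∀ x v, c * ‖v‖ ^ 2 ≤ fderiv ℝ (fderiv ℝ V) x v v)
    (hI : Integrable fun z => Real.exp (-V z)) :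
    IsTiltBase β (β / 2 + c) (tiltBase β V) where
  beta_pos := hβ
  beta_lt := by linarith
  measurable := by
    have h1 := measurable_gaussLaplace (β := β) hV.continuous
    have h2 := hV.continuous.measurable
    unfold tiltBase
    fun_prop
  pos x := div_pos (Real.exp_pos _) (Real.sqrt_pos.2 (gaussLaplace_pos hβ hV.continuous hI x))
  bound := by
    obtain ⟨a, ha, hM⟩ := exists_gaussLaplace_ge hβ hV.continuous hI
    -- The exponent of q has quadratic coefficient β/4 + c/2 = β/2 + 2δ. One δ absorbs the linear
    -- term B‖x‖, the other remains as margin.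
    set δ := (c / 2 - β / 4) / 2
    have hδ : 0 < δ := by simp only [δ]; linarith
    set B := ‖fderiv ℝ V 0‖ + β / 2
    refine ⟨Real.exp (-V 0 + B ^ 2 / (4 * δ)) / √a, δ, hδ, fun x => ?_⟩
    have h1 : √a * Real.exp (-(β / 2) * ‖x‖) ≤ √(gaussLaplace β V x) := by
      refine Real.le_sqrt_of_sq_le ?_
      rw [mul_pow, Real.sq_sqrt ha.le, ← Real.exp_nat_mul]
      convert hM x using 3
      push_cast
      ring
    have h2 := tangent_le_of_hessian hV hV' h x
    have h3 : -(‖fderiv ℝ V 0‖ * ‖x‖) ≤ fderiv ℝ V 0 x :=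
      (abs_le.1 ((fderiv ℝ V 0).le_opNorm x)).1
    have h4 : B * ‖x‖ - δ * ‖x‖ ^ 2 ≤ B ^ 2 / (4 * δ) := by
      rw [le_div_iff₀ (by positivity)]
      nlinarith [sq_nonneg (B - 2 * δ * ‖x‖)]
    have hsa : 0 < √a := Real.sqrt_pos.2 ha
    calc tiltBase β V x
        ≤ Real.exp (-(β / 4 * ‖x‖ ^ 2) - V x) / (√a * Real.exp (-(β / 2) * ‖x‖)) :=
          div_le_div_of_nonneg_left (Real.exp_pos _).le (by positivity) h1
      _ = Real.exp (-(β / 4 * ‖x‖ ^ 2) - V x + β / 2 * ‖x‖) / √a := by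
          rw [neg_mul, Real.exp_neg, Real.exp_add]
          field_simp
      _ ≤ Real.exp (-V 0 + B ^ 2 / (4 * δ) + -(β / 2 + δ) * ‖x‖ ^ 2) / √a := by
          refine div_le_div_of_nonneg_right (Real.exp_le_exp.2 ?_) hsa.le
          have e : δ * ‖x‖ ^ 2 = (c / 2 - β / 4) / 2 * ‖x‖ ^ 2 := rfl
          have e' : B * ‖x‖ = ‖fderiv ℝ V 0‖ * ‖x‖ + β / 2 * ‖x‖ := add_mul _ _ _
          linarith
      _ = _ := by rw [Real.exp_add]; ring
  midpoint x y := by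
    set m := (1 / 2 : ℝ) • (x + y)
    have hMx := gaussLaplace_pos hβ hV.continuous hI x
    have hMy := gaussLaplace_pos hβ hV.continuous hI y
    have hMm := gaussLaplace_pos hβ hV.continuous hI m
    have h1 := midpoint_le_of_hessian hV hV' h x y
    have h2 : gaussLaplace β V m ≤ √(gaussLaplace β V x) * √(gaussLaplace β V y) := by
      rw [← Real.sqrt_mul hMx.le]
      exact Real.le_sqrt_of_sq_le (gaussLaplace_midpoint_le hβ hV.continuous hI x y)
    -- The factor exp(-β‖·‖²/4) contributes β‖x - y‖²/8, which accounts for the β/2 in the constant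
    -- β/2 + c.
    have h3 : ‖x‖ ^ 2 + ‖y‖ ^ 2 = 2 * ‖m‖ ^ 2 + 1 / 2 * ‖x - y‖ ^ 2 := by
      have := parallelogram_law_with_norm ℝ x y
      simp only [m, norm_smul]
      norm_num
      nlinarith
    calc tiltBase β V x * tiltBase β V y
        = Real.exp (-(β / 4 * ‖x‖ ^ 2) - V x + (-(β / 4 * ‖y‖ ^ 2) - V y)) /
          (√(gaussLaplace β V x) * √(gaussLaplace β V y)) := by
          rw [tiltBase, tiltBase, div_mul_div_comm, ← Real.exp_add]
      _ ≤ Real.exp (2 * (-(β / 4 * ‖m‖ ^ 2) - V m) + -((β / 2 + c) / 4) * ‖x - y‖ ^ 2) /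
          gaussLaplace β V m := by
          refine div_le_div₀ (Real.exp_pos _).le (Real.exp_le_exp.2 ?_) hMm h2
          have h3' : β / 4 * ‖x‖ ^ 2 + β / 4 * ‖y‖ ^ 2 =
              β / 4 * (2 * ‖m‖ ^ 2 + 1 / 2 * ‖x - y‖ ^ 2) := by rw [← h3]; ring
          linarith
      _ = _ := by
          rw [Real.exp_add, tiltBase, div_pow, Real.sq_sqrt hMm.le, ← Real.exp_nat_mul]
          push_cast
          ring

end GaussLaplace

/-! ### The diffusion-map kernels as an exponential family -/

namespace DiffusionMapGain

variable {d : ℕ} {ε c_v β c L : ℝ} {ρ V h φ ψ q : EuclideanSpace ℝ (Fin d) → ℝ}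

theorem lipBound_gradSup (hC1 : ContDiff ℝ 1 h) (hLip : ∃ L, LipschitzWith L h) :
    0 ≤ gradSup h ∧ LipBound (gradSup h) h := by
  obtain ⟨L, hL⟩ := hLip
  have hd : Differentiable ℝ h := hC1.differentiable (by norm_num)
  have hnorm : ∀ x, ‖gradient h x‖ = ‖fderiv ℝ h x‖ := fun x => by
    rw [gradient, LinearIsometryEquiv.norm_map]
  -- Without boundedness the real supremum would take its default value 0.
  have hbdd : BddAbove (Set.range fun x => ‖gradient h x‖) := ⟨L, by
    rintro _ ⟨x, rfl⟩
    dsimp only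
    rw [hnorm]
    exact norm_fderiv_le_of_lipschitz ℝ hL⟩
  refine ⟨Real.iSup_nonneg fun x => norm_nonneg _, fun x y => ?_⟩
  refine Convex.norm_image_sub_le_of_norm_fderiv_le (𝕜 := ℝ) (s := Set.univ)
    (fun z _ => hd z) (fun z _ => ?_) convex_univ (Set.mem_univ _) (Set.mem_univ _)
  rw [← hnorm]
  exact le_ciSup hbdd z

/-- The Gaussian kernel factors through the exponential of the inner product. -/
theorem gaussKernel_eq (hε : 0 < ε) (x y : EuclideanSpace ℝ (Fin d)) :
    gaussKernel ε x y = (4 * Real.pi * ε) ^ (-(d : ℝ) / 2) *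
      (Real.exp (-(1 / (2 * ε) / 2 * ‖x‖ ^ 2)) *
        Real.exp (1 / (2 * ε) * inner ℝ x y - 1 / (2 * ε) / 2 * ‖y‖ ^ 2)) := by
  rw [gaussKernel, ← Real.exp_add, @norm_sub_sq_real]
  congr 2
  field_simp
  ring

theorem kernelConv_gaussKernel (hε : 0 < ε) (hρ : ∀ x, ρ x = Real.exp (-V x))
    (x : EuclideanSpace ℝ (Fin d)) :
    kernelConv (gaussKernel ε) ρ x = (4 * Real.pi * ε) ^ (-(d : ℝ) / 2) *
      (Real.exp (-(1 / (2 * ε) / 2 * ‖x‖ ^ 2)) * gaussLaplace (1 / (2 * ε)) V x) := by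
  rw [kernelConv, gaussLaplace, ← integral_const_mul, ← integral_const_mul]
  congr 1 with z
  rw [gaussKernel_eq hε, hρ, sub_eq_add_neg _ (V z), Real.exp_add _ (-V z)]
  ring

theorem sqrt_kernelConv_gaussKernel (hε : 0 < ε) (hρ : ∀ x, ρ x = Real.exp (-V x))
    (x : EuclideanSpace ℝ (Fin d)) :
    √(kernelConv (gaussKernel ε) ρ x) = √((4 * Real.pi * ε) ^ (-(d : ℝ) / 2)) *
      (Real.exp (-(1 / (2 * ε) / 4 * ‖x‖ ^ 2)) * √(gaussLaplace (1 / (2 * ε)) V x)) := by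
  have h1 : (0 : ℝ) ≤ (4 * Real.pi * ε) ^ (-(d : ℝ) / 2) := by positivity
  rw [kernelConv_gaussKernel hε hρ, Real.sqrt_mul h1, Real.sqrt_mul (Real.exp_pos _).le]
  congr 2
  rw [Real.sqrt_eq_iff_mul_self_eq (Real.exp_pos _).le (Real.exp_pos _).le, ← Real.exp_add]
  ring_nf

/-- The extra factor ρ(x) makes the kernel symmetric; it cancels in p_ε and is already present in
π_ε. -/
theorem kKernel_mul_eq (hε : 0 < ε) (hρ : ∀ x, ρ x = Real.exp (-V x))
    (hM : ∀ x, 0 < gaussLaplace (1 / (2 * ε)) V x) (x y : EuclideanSpace ℝ (Fin d)) :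
    ρ x * (kKernel ε ρ x y * ρ y) = tiltBase (1 / (2 * ε)) V x *
      (Real.exp (1 / (2 * ε) * inner ℝ x y) * tiltBase (1 / (2 * ε)) V y) := by
  have h1 : (0 : ℝ) < (4 * Real.pi * ε) ^ (-(d : ℝ) / 2) := by positivity
  have hx := Real.sqrt_pos.2 (hM x)
  have hy := Real.sqrt_pos.2 (hM y)
  have h2 := Real.sqrt_pos.2 h1
  have split : ∀ z : EuclideanSpace ℝ (Fin d), Real.exp (-(1 / (2 * ε) / 2 * ‖z‖ ^ 2)) =
      Real.exp (-(1 / (2 * ε) / 4 * ‖z‖ ^ 2)) * Real.exp (-(1 / (2 * ε) / 4 * ‖z‖ ^ 2)) :=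
    fun z => by
      rw [← Real.exp_add]
      ring_nf
  rw [kKernel, gaussKernel_eq hε, sqrt_kernelConv_gaussKernel hε hρ,
    sqrt_kernelConv_gaussKernel hε hρ, tiltBase, tiltBase, hρ, hρ,
    sub_eq_add_neg _ (1 / (2 * ε) / 2 * ‖y‖ ^ 2), sub_eq_add_neg _ (V x),
    sub_eq_add_neg _ (V y), Real.exp_add _ (-V x), Real.exp_add _ (-V y),
    Real.exp_add _ (-(1 / (2 * ε) / 2 * ‖y‖ ^ 2)), split x, split y]
  nth_rewrite 1 [← Real.mul_self_sqrt h1.le]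
  have e1 := (Real.exp_pos (-(1 / (2 * ε) / 4 * ‖x‖ ^ 2))).ne'
  have e2 := (Real.exp_pos (-(1 / (2 * ε) / 4 * ‖y‖ ^ 2))).ne'
  generalize Real.exp (-(1 / (2 * ε) / 4 * ‖x‖ ^ 2)) = a at *
  generalize Real.exp (-(1 / (2 * ε) / 4 * ‖y‖ ^ 2)) = b at *
  generalize √((4 * Real.pi * ε) ^ (-(d : ℝ) / 2)) = k at *
  generalize Real.exp (1 / (2 * ε) * inner ℝ x y) = g at *
  field_simp

theorem mul_kernelConv_kKernel (hε : 0 < ε) (hρ : ∀ x, ρ x = Real.exp (-V x))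
    (hM : ∀ x, 0 < gaussLaplace (1 / (2 * ε)) V x) (x : EuclideanSpace ℝ (Fin d)) :
    ρ x * kernelConv (kKernel ε ρ) ρ x =
      tiltBase (1 / (2 * ε)) V x * tiltZ (1 / (2 * ε)) (tiltBase (1 / (2 * ε)) V) x := by
  rw [kernelConv, tiltZ, tiltInt, ← integral_const_mul, ← integral_const_mul]
  congr 1 with y
  rw [kKernel_mul_eq hε hρ hM, mul_one]

/-- `ε` and `ρ` are such that the transition density is that of the exponential family with base
density `q`, and the invariant density is its stationary density. -/
structure IsTiltRepresentation (ε : ℝ) (ρ q : EuclideanSpace ℝ (Fin d) → ℝ) (β c : ℝ) : Prop where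
  isTiltBase : IsTiltBase β c q
  pKernel_eq : ∀ x y, pKernel ε ρ x y = Real.exp (β * inner ℝ x y) * q y / tiltZ β q x
  invDensity_eq : ∀ x, invDensity ε ρ x = q x * tiltZ β q x / ∫ z, q z * tiltZ β q z

theorem isTiltRepresentation (hε : 0 < ε) (hc : 1 / (4 * ε) < c_v)
    (hρ : IsStronglyLogConcaveDensity c_v ρ) :
    ∃ q, IsTiltRepresentation ε ρ q (1 / (2 * ε)) (1 / (4 * ε) + c_v) := by
  obtain ⟨hint, V, hV, hV', hVρ, hconv⟩ := hρ
  have hβ : 0 < 1 / (2 * ε) := by positivity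
  have h4 : 1 / (4 * ε) = 1 / (2 * ε) / 2 := by field_simp; norm_num
  -- A non-integrable density would have integral 0 by convention, contradicting total mass 1.
  have hI : Integrable fun z => Real.exp (-V z) := by
    by_contra hcon
    simp_rw [hVρ] at hint
    rw [integral_undef hcon] at hint
    exact zero_ne_one hint
  have hM := gaussLaplace_pos hβ hV.continuous hI
  have hq : IsTiltBase (1 / (2 * ε)) (1 / (4 * ε) + c_v) (tiltBase (1 / (2 * ε)) V) := by
    rw [h4] at hc ⊢
    exact isTiltBase_tiltBase hβ hc hV hV' hconv hI
  refine ⟨tiltBase (1 / (2 * ε)) V, hq, fun x y => ?_, fun x => ?_⟩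
  · have hρx : ρ x ≠ 0 := by
      rw [hVρ]
      exact (Real.exp_pos _).ne'
    rw [pKernel, ← mul_div_mul_left _ _ hρx, kKernel_mul_eq hε hVρ hM,
      mul_kernelConv_kKernel hε hVρ hM, mul_div_mul_left _ _ (hq.pos x).ne']
  · simp_rw [invDensity, mul_kernelConv_kKernel hε hVρ hM]

/-! ### Solutions of the fixed point equation and bounds on the gain -/

namespace IsTiltRepresentation

theorem integrable_mul_invDensity_iff (hr : IsTiltRepresentation ε ρ q β c) :
    Integrable (fun x => φ x * invDensity ε ρ x) ↔
      Integrable fun x => φ x * (q x * tiltZ β q x) := by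
  have hN := hr.isTiltBase.integral_weight_pos.ne'
  simp_rw [hr.invDensity_eq, ← mul_div_assoc]
  refine ⟨fun h => ?_, fun h => h.div_const _⟩
  refine (h.mul_const (∫ z, q z * tiltZ β q z)).congr (.of_forall fun x => ?_)
  dsimp only
  rw [div_mul_cancel₀ _ hN]

theorem integral_mul_invDensity (hr : IsTiltRepresentation ε ρ q β c)
    (φ : EuclideanSpace ℝ (Fin d) → ℝ) :
    ∫ x, φ x * invDensity ε ρ x =
      (∫ x, φ x * (q x * tiltZ β q x)) / ∫ z, q z * tiltZ β q z := by
  simp_rw [hr.invDensity_eq, ← mul_div_assoc]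
  rw [integral_div]

theorem integrable_pKernel_mul_iff (hr : IsTiltRepresentation ε ρ q β c)
    {x : EuclideanSpace ℝ (Fin d)} :
    Integrable (fun y => pKernel ε ρ x y * φ y) ↔
      Integrable fun y => Real.exp (β * inner ℝ x y) * q y * φ y := by
  have hZ := (hr.isTiltBase.tiltZ_pos x).ne'
  simp_rw [hr.pKernel_eq, div_mul_eq_mul_div]
  refine ⟨fun h => ?_, fun h => h.div_const _⟩
  refine (h.mul_const (tiltZ β q x)).congr (.of_forall fun y => ?_)
  dsimp only
  rw [div_mul_cancel₀ _ hZ]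

theorem integral_pKernel_mul (hr : IsTiltRepresentation ε ρ q β c)
    (φ : EuclideanSpace ℝ (Fin d) → ℝ) (x : EuclideanSpace ℝ (Fin d)) :
    ∫ y, pKernel ε ρ x y * φ y = tiltMean β q φ x := by
  simp_rw [hr.pKernel_eq, div_mul_eq_mul_div]
  rw [integral_div]
  rfl

theorem integrable_mul_invDensity (hr : IsTiltRepresentation ε ρ q β c) (hφ : LipBound L φ) :
    Integrable fun x => φ x * invDensity ε ρ x :=
  hr.integrable_mul_invDensity_iff.2 (hr.isTiltBase.integrable_mul_weight (.of_lipBound hφ))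

theorem integrable_pKernel_mul (hr : IsTiltRepresentation ε ρ q β c) (hφ : ExpGrowth φ)
    (x : EuclideanSpace ℝ (Fin d)) : Integrable fun y => pKernel ε ρ x y * φ y :=
  hr.integrable_pKernel_mul_iff.2 (hr.isTiltBase.integrable_tilt hφ x)

theorem exists_solution (hr : IsTiltRepresentation ε ρ q β c) (hε : 0 < ε) (hL : 0 ≤ L)
    (hh : LipBound L h) :
    ∃ φ, IsFixedPointSolution ε ρ h φ ∧ LipBound (ε * (L / (1 - β / c))) φ := by
  have hq := hr.isTiltBase
  have hN := hq.integral_weight_pos.ne'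
  obtain ⟨u, hu, hfix⟩ := hq.exists_lipBound_solution hL (hh.sub_const (hHat ε ρ h)) (by
    simp_rw [sub_mul]
    rw [integral_sub (hq.integrable_mul_weight (.of_lipBound hh))
      (hq.integrable_weight.const_mul _), integral_const_mul, hHat, hr.integral_mul_invDensity,
      div_mul_cancel₀ _ hN, sub_self])
  have hφ := hu.const_mul ε
  rw [abs_of_pos hε] at hφ
  refine ⟨fun x => ε * u x, ⟨hr.integrable_mul_invDensity hφ,
    hr.integrable_pKernel_mul (.of_lipBound hφ), fun x => ?_⟩, hφ⟩
  rw [markovOp]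
  simp_rw [mul_left_comm _ ε]
  rw [integral_const_mul, hr.integral_pKernel_mul, ← mul_add, ← hfix]

theorem solution_unique (hr : IsTiltRepresentation ε ρ q β c)
    (hφ : IsFixedPointSolution ε ρ h φ) (hψ : IsFixedPointSolution ε ρ h ψ) :
    ∃ a, ∀ x, φ x = ψ x + a := by
  have hq := hr.isTiltBase
  have hN := hq.integral_weight_pos.ne'
  set N := ∫ z, q z * tiltZ β q z
  have hφ1 := hr.integrable_mul_invDensity_iff.1 hφ.integrable_inv
  have hψ1 := hr.integrable_mul_invDensity_iff.1 hψ.integrable_inv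
  have hφ2 := fun x => hr.integrable_pKernel_mul_iff.1 (hφ.integrable_op x)
  have hψ2 := fun x => hr.integrable_pKernel_mul_iff.1 (hψ.integrable_op x)
  set a := (∫ x, (φ x - ψ x) * (q x * tiltZ β q x)) / N
  have hI : Integrable fun x => (φ x - ψ x) * (q x * tiltZ β q x) := by
    simp_rw [sub_mul]
    exact hφ1.sub hψ1
  have hop : ∀ x, Integrable fun y => Real.exp (β * inner ℝ x y) * q y * (φ y - ψ y - a) :=
    fun x => by
      simp_rw [mul_sub]
      exact ((hφ2 x).sub (hψ2 x)).sub (by simpa only [mul_one] using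
        (hq.integrable_tilt (.const a) x))
  have key := hq.eq_zero_of_tiltMean_eq (f := fun x => φ x - ψ x - a) (by
      simp_rw [sub_mul _ a]
      exact hI.sub (hq.integrable_weight.const_mul a)) hop (fun x => ?_) (by
      simp_rw [sub_mul _ a]
      rw [integral_sub hI (hq.integrable_weight.const_mul a), integral_const_mul,
        div_mul_cancel₀ _ hN, sub_self])
  · refine ⟨a, fun x => ?_⟩
    have := congrFun key x
    simp only [Pi.zero_apply] at this
    linarith
  · have e : tiltInt β q (fun x => φ x - ψ x - a) x =
        tiltInt β q φ x - tiltInt β q ψ x - tiltInt β q (fun _ => a) x := by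
      have h1 : Integrable fun y => Real.exp (β * inner ℝ x y) * q y * φ y -
          Real.exp (β * inner ℝ x y) * q y * ψ y := (hφ2 x).sub (hψ2 x)
      rw [tiltInt, tiltInt, tiltInt, tiltInt, ← integral_sub (hφ2 x) (hψ2 x),
        ← integral_sub h1 (hq.integrable_tilt (.const a) x)]
      simp_rw [mul_sub]
    have e' : tiltMean β q (fun x => φ x - ψ x - a) x =
        tiltMean β q φ x - tiltMean β q ψ x - a := by
      rw [tiltMean, e, sub_div, sub_div]
      exact congrArg (_ - ·) (hq.tiltMean_const a x)
    have h1 := hφ.eq x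
    have h2 := hψ.eq x
    rw [markovOp, hr.integral_pKernel_mul] at h1 h2
    rw [e']
    linarith

/-- A solution is only assumed integrable; its regularity is that of the Neumann series, from which
it differs by a constant. -/
theorem lipBound_of_solution (hr : IsTiltRepresentation ε ρ q β c) (hε : 0 < ε) (hL : 0 ≤ L)
    (hh : LipBound L h) (hφ : IsFixedPointSolution ε ρ h φ) :
    LipBound (ε * (L / (1 - β / c))) φ := by
  obtain ⟨ψ, hψ, hψL⟩ := hr.exists_solution hε hL hh
  obtain ⟨a, ha⟩ := hr.solution_unique hφ hψ
  intro x y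
  rw [ha x, ha y, add_sub_add_right_eq_sub]
  exact hψL x y

theorem gainIntegrable (hr : IsTiltRepresentation ε ρ q β c) (hR : LipBound L (rFun ε h φ))
    (x : EuclideanSpace ℝ (Fin d)) : GainIntegrable ε ρ h φ x := by
  have hR' := ExpGrowth.of_lipBound hR
  have vec : ∀ g : EuclideanSpace ℝ (Fin d) → ℝ, ExpGrowth g →
      Integrable fun y => (g y * pKernel ε ρ x y) • y := fun g hg => by
    refine ((hr.integrable_pKernel_mul (hg.mul .norm) x).norm).mono' ?_ (.of_forall fun y => ?_)
    · have hid : AEStronglyMeasurable (fun y : EuclideanSpace ℝ (Fin d) => y) volume :=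
        continuous_id.aestronglyMeasurable
      have hm : AEStronglyMeasurable (fun y => g y * pKernel ε ρ x y) volume := by
        simpa only [mul_comm] using (hr.integrable_pKernel_mul hg x).1
      exact hm.smul hid
    · rw [norm_smul, norm_mul, norm_mul (pKernel ε ρ x y), norm_mul (g y), norm_norm]
      exact le_of_eq (by ring)
  refine ⟨vec _ hR', ?_, ?_⟩
  · simpa only [mul_comm] using hr.integrable_pKernel_mul hR' x
  · simpa only [one_mul] using vec _ (.const 1)

/-- Each component of the gain is β times a covariance, that is, a directional derivative of the
mean of R_ε. -/
theorem inner_meanFieldGain (hr : IsTiltRepresentation ε ρ q β c) (hβ : β = 1 / (2 * ε))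
    (hR : LipBound L (rFun ε h φ)) (u x : EuclideanSpace ℝ (Fin d)) :
    inner ℝ u (meanFieldGain ε ρ h φ x) =
      β * (tiltMean β q (fun y => rFun ε h φ y * inner ℝ u y) x -
        tiltMean β q (rFun ε h φ) x * tiltMean β q (fun y => inner ℝ u y) x) := by
  obtain ⟨h1, h2, h3⟩ := hr.gainIntegrable hR x
  rw [meanFieldGain, inner_sub_right, inner_smul_right, inner_smul_right, inner_smul_right,
    ← integral_inner h1, ← integral_inner h3, ← hβ, ← mul_sub]
  simp_rw [← hr.integral_pKernel_mul, inner_smul_right]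
  congr 3
  · congr 1 with y
    ring
  · congr 1 with y
    ring

theorem norm_meanFieldGain_le (hr : IsTiltRepresentation ε ρ q β c) (hβ : β = 1 / (2 * ε))
    (hL : 0 ≤ L) (hR : LipBound L (rFun ε h φ)) (x : EuclideanSpace ℝ (Fin d)) :
    ‖meanFieldGain ε ρ h φ x‖ ≤ β * L / c := by
  set K := meanFieldGain ε ρ h φ x with hK
  have hq := hr.isTiltBase
  have hβ0 := hq.beta_pos
  have hc := hq.beta_pos.trans hq.beta_lt
  -- Testing the gain against itself bounds ‖K‖² by a multiple of ‖K‖, so the norm bound carries no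
  -- dimensional factor.
  have h1 := hr.inner_meanFieldGain hβ hR K x
  have h2 := (le_abs_self _).trans (hq.abs_covariance_le hL hR x K)
  rw [← hK, real_inner_self_eq_norm_sq] at h1
  have h3 : ‖K‖ ^ 2 ≤ β * L / c * ‖K‖ := by
    rw [h1]
    calc _ ≤ β * (L * ‖K‖ / c) := mul_le_mul_of_nonneg_left h2 hβ0.le
      _ = _ := by ring
  rcases (norm_nonneg K).eq_or_lt with h0 | h0
  · rw [← h0]
    positivity
  · rw [sq] at h3
    exact le_of_mul_le_mul_right h3 h0

theorem differentiable_inner_meanFieldGain (hr : IsTiltRepresentation ε ρ q β c)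
    (hβ : β = 1 / (2 * ε)) (hR : LipBound L (rFun ε h φ)) (u : EuclideanSpace ℝ (Fin d)) :
    Differentiable ℝ fun x => (inner ℝ u (meanFieldGain ε ρ h φ x) : ℝ) := by
  have hq := hr.isTiltBase
  have hR' := ExpGrowth.of_lipBound hR
  simp_rw [hr.inner_meanFieldGain hβ hR]
  exact ((hq.differentiable_tiltMean (hR'.mul (.inner_left u))).sub
    ((hq.differentiable_tiltMean hR').mul
      (hq.differentiable_tiltMean (.inner_left u)))).const_mul β

theorem differentiable_meanFieldGain (hr : IsTiltRepresentation ε ρ q β c)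
    (hβ : β = 1 / (2 * ε)) (hR : LipBound L (rFun ε h φ)) :
    Differentiable ℝ (meanFieldGain ε ρ h φ) := by
  rw [differentiable_euclidean]
  intro i
  simpa [EuclideanSpace.inner_single_left] using
    hr.differentiable_inner_meanFieldGain hβ hR (EuclideanSpace.single i 1)

theorem inner_fderiv_meanFieldGain (hr : IsTiltRepresentation ε ρ q β c)
    (hβ : β = 1 / (2 * ε)) (hR : LipBound L (rFun ε h φ)) (u x v : EuclideanSpace ℝ (Fin d)) :
    inner ℝ u (fderiv ℝ (meanFieldGain ε ρ h φ) x v) =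
      β ^ 2 * tiltMean β q (fun y => (rFun ε h φ y - tiltMean β q (rFun ε h φ) x) *
        ((inner ℝ u y - tiltMean β q (fun y => inner ℝ u y) x) *
          (inner ℝ v y - tiltMean β q (fun y => inner ℝ v y) x))) x := by
  have hq := hr.isTiltBase
  have hR' := ExpGrowth.of_lipBound hR
  have hu := ExpGrowth.inner_left u
  have h1 := ((innerSL ℝ u).hasFDerivAt.comp x
    (hr.differentiable_meanFieldGain hβ hR x).hasFDerivAt).fderiv
  have h2 : (innerSL ℝ u ∘ meanFieldGain ε ρ h φ) = fun x =>
      β * (tiltMean β q (fun y => rFun ε h φ y * inner ℝ u y) x -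
        tiltMean β q (rFun ε h φ) x * tiltMean β q (fun y => inner ℝ u y) x) :=
    funext fun x => hr.inner_meanFieldGain hβ hR u x
  have h3 := (((hq.differentiable_tiltMean (hR'.mul hu) x).hasFDerivAt.sub
    ((hq.differentiable_tiltMean hR' x).hasFDerivAt.mul
      (hq.differentiable_tiltMean hu x).hasFDerivAt)).const_mul β).fderiv
  have h4 := congrArg (fun A => A v) (h1.symm.trans ((congrArg (fderiv ℝ · x) h2).trans h3))
  simp only [ContinuousLinearMap.comp_apply, innerSL_apply_apply, smul_apply, sub_apply,
    add_apply, smul_eq_mul, hq.fderiv_tiltMean (hR'.mul hu), hq.fderiv_tiltMean hR',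
    hq.fderiv_tiltMean hu] at h4
  rw [h4, hq.tiltMean_third_cumulant hR' hu (.inner_left v)]
  ring

theorem jacobianFrobenius_le (hr : IsTiltRepresentation ε ρ q β c) (hβ : β = 1 / (2 * ε))
    (hL : 0 ≤ L) (hR : LipBound L (rFun ε h φ)) (x : EuclideanSpace ℝ (Fin d)) :
    jacobianFrobenius (meanFieldGain ε ρ h φ) x ≤ d * (β ^ 2 * (4 * L * (1 / c ^ (3 / 2 : ℝ)))) := by
  have hq := hr.isTiltBase
  have hc := hq.beta_pos.trans hq.beta_lt
  have := hq.isProbabilityMeasure x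
  have hsq : (1 / c ^ (3 / 2 : ℝ)) ^ 2 = 1 / c ^ 3 := by
    rw [div_pow, one_pow, ← Real.rpow_natCast, ← Real.rpow_mul hc.le]
    norm_num
  have hlip : ∀ i : Fin d, LipBound 1 fun y : EuclideanSpace ℝ (Fin d) =>
      (inner ℝ (EuclideanSpace.single i (1 : ℝ)) y : ℝ) := fun i => by
    simpa using lipBound_inner_left (EuclideanSpace.single i (1 : ℝ))
  have hentry : ∀ i j : Fin d,
      (fderiv ℝ (meanFieldGain ε ρ h φ) x (EuclideanSpace.single j 1) i) ^ 2 ≤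
        (β ^ 2 * (4 * L * (1 / c ^ (3 / 2 : ℝ)))) ^ 2 := fun i j => by
    have h1 := hr.inner_fderiv_meanFieldGain hβ hR (EuclideanSpace.single i 1) x
      (EuclideanSpace.single j 1)
    rw [EuclideanSpace.inner_single_left] at h1
    simp only [map_one, one_mul] at h1
    have h2 := (hq.lipschitzConcentration x).sq_third_cumulant_le hc hR (hlip i) (hlip j)
    simp_rw [hq.integral_tiltMeasure] at h2
    rw [h1, mul_pow, mul_pow (β ^ 2), mul_pow (4 * L), hsq]
    refine mul_le_mul_of_nonneg_left (h2.trans (le_of_eq ?_)) (by positivity)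
    ring
  rw [jacobianFrobenius]
  refine Real.sqrt_le_iff.2 ⟨by positivity, ?_⟩
  calc _ ≤ ∑ _i : Fin d, ∑ _j : Fin d, (β ^ 2 * (4 * L * (1 / c ^ (3 / 2 : ℝ)))) ^ 2 :=
        Finset.sum_le_sum fun i _ => Finset.sum_le_sum fun j _ => hentry i j
    _ = _ := by
        simp only [Finset.sum_const, Finset.card_univ, Fintype.card_fin, nsmul_eq_mul]
        ring

end IsTiltRepresentation

end DiffusionMapGain

/-! ### Assembling the constants -/

theorem lemma2 (d : ℕ) (ε c_v : ℝ) (hε : 0 < ε) (hc : 1 / (4 * ε) < c_v)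
    (ρ : EuclideanSpace ℝ (Fin d) → ℝ)
    (hρ : DiffusionMapGain.IsStronglyLogConcaveDensity c_v ρ)
    (h : EuclideanSpace ℝ (Fin d) → ℝ) (hC1 : ContDiff ℝ 1 h)
    (hLip : ∃ L, LipschitzWith L h)
    (c_g : ℝ) (hcg : c_g = 1 / (4 * ε) + c_v) :
    -- `ĥ_ε` is well defined and the fixed point equation has a solution, unique up to a constant
    (MeasureTheory.Integrable fun x => h x * DiffusionMapGain.invDensity ε ρ x) ∧
    (∃ φ, DiffusionMapGain.IsFixedPointSolution ε ρ h φ) ∧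
    (∀ φ ψ, DiffusionMapGain.IsFixedPointSolution ε ρ h φ →
      DiffusionMapGain.IsFixedPointSolution ε ρ h ψ → ∃ c, ∀ x, φ x = ψ x + c) ∧
    -- for every solution the gain is well defined and differentiable, with the stated bounds
    ∀ φ, DiffusionMapGain.IsFixedPointSolution ε ρ h φ →
      (∀ x, DiffusionMapGain.GainIntegrable ε ρ h φ x) ∧
      Differentiable ℝ (DiffusionMapGain.meanFieldGain ε ρ h φ) ∧
      (∀ x, ‖DiffusionMapGain.meanFieldGain ε ρ h φ x‖ ≤
        DiffusionMapGain.gradSup h / (2 * c_g) *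
          ((4 * ε * c_g - 1) / (2 * ε * c_g - 1))) ∧
      (∀ x, DiffusionMapGain.jacobianFrobenius (DiffusionMapGain.meanFieldGain ε ρ h φ) x ≤
        d * DiffusionMapGain.gradSup h / ε * (1 / c_g ^ (3 / 2 : ℝ)) *
          ((4 * ε * c_g - 1) / (2 * ε * c_g - 1))) := by
  obtain ⟨q, hr⟩ := DiffusionMapGain.isTiltRepresentation hε hc hρ
  rw [← hcg] at hr
  obtain ⟨hL, hh⟩ := DiffusionMapGain.lipBound_gradSup hC1 hLip
  generalize DiffusionMapGain.gradSup h = L at *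
  have hq := hr.isTiltBase
  have hlt := hq.beta_lt
  have hcpos := hq.beta_pos.trans hlt
  have h2c : 0 < 2 * ε * c_g - 1 := by
    rw [div_lt_iff₀ (by positivity)] at hlt
    linarith
  obtain ⟨φ₀, hφ₀, -⟩ := hr.exists_solution hε hL hh
  refine ⟨hr.integrable_mul_invDensity hh, ⟨φ₀, hφ₀⟩, fun φ ψ hφ hψ => hr.solution_unique hφ hψ,
    fun φ hφ => ?_⟩
  -- The Lipschitz constant of φ + εh: εL(1/(1 - β/c_g) + 1), where 1/(1 - β/c_g) = 2εc_g/(2εc_g -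
  -- 1).
  set M := ε * L * ((4 * ε * c_g - 1) / (2 * ε * c_g - 1)) with hM
  have hM0 : 0 ≤ M := mul_nonneg (by positivity) (div_nonneg (by linarith) h2c.le)
  have hR : LipBound M (DiffusionMapGain.rFun ε h φ) := by
    have h1 := (hr.lipBound_of_solution hε hL hh hφ).add (hh.const_mul ε)
    refine h1.mono (le_of_eq ?_)
    have e : 1 - 1 / (2 * ε) / c_g = (2 * ε * c_g - 1) / (2 * ε * c_g) := by field_simp
    have e' : 4 * ε * c_g - 1 = 2 * ε * c_g - 1 + 2 * ε * c_g := by ring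
    rw [e, abs_of_pos hε, hM, e', add_div, div_self h2c.ne', div_div_eq_mul_div]
    ring
  refine ⟨hr.gainIntegrable hR, hr.differentiable_meanFieldGain rfl hR,
    fun x => (hr.norm_meanFieldGain_le rfl hM0 hR x).trans (le_of_eq ?_),
    fun x => (hr.jacobianFrobenius_le rfl hM0 hR x).trans (le_of_eq ?_)⟩
  · rw [hM]
    field_simp
  · rw [hM]
    field_simp
    norm_num
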